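/- **Setting.** Let $\mathfrak B=\{\bot,\mathbf Y,\mathbf N\}$, ordered by $u\le v$ iff $u=\bot$ or $u=v$, with the involution $u\mapsto\overline u$ exchanging $\mathbf Y$ and $\mathbf N$, and the commutative product $\bullet$ with $x\bullet\mathbf Y=x$, $x\bullet\mathbf N=\mathbf N$, $\bot\bullet\bot=\bot$. Let $S'$ be a poset with bottom $\bot$ in which every nonempty subset has an infimum and every $\sigma$ is the infimum of the maximal elements above it. Let $\star$ be a map from $S'\setminus\{\bot\}$ to itself with $\sigma^{\star\star}=\sigma$, with $\sigma\le\tau\Rightarrow\tau^\star\le\sigma^\star$, and such that $\sigma,\sigma^\star$ never have a common upper bound. Assume the Finite Rank Condition (for every $U\subseteq S'$ bounded above there is a finite $V$, each element of which is below some element of $U$, with $\bigsqcup V=\bigsqcup U$), and that every chain of $S'$ is bounded above. *Maximal ontic completion.* For $U,V\subseteq S'$ write $U\sqsubseteq V$ iff each element of $U$ is below some element of $V$. Let $\mathfrak c(U)$ be the set of maximal elements of $\{\bigsqcup V\mid V\sqsubseteq U,\ V\text{ bounded above}\}$, and $cl_c(U)$ the set of maximal elements of $\bigcup_{n\ge1}\mathfrak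 c^{n}(U)$. Let $\mathcal K$ be the set of $U\subseteq S'\setminus\{\bot\}$ such that $\sigma^\star\not\le\sigma'$ for all $\sigma,\sigma'\in U$, and $\mathcal Q_c=\{U\subseteq S'\setminus\{\bot\}\mid cl_c(U)\in\mathcal K\}\cup\{\{\bot\}\}$. The maximal ontic completion of $(S',\star)$ is $S=\{cl_c(U)\mid U\in\mathcal Q_c\}$, ordered by $\sqsubseteq$. Each $\sigma\in S'$ is identified with $\{\sigma\}\in S$. The elements of $\overline S:=S'\subseteq S$ are the real states, those of $S\setminus\overline S$ the hidden states, and the pure states are the maximal elements of $\overline S$. *Effects.* For a poset $P$, an effect is a symbol $\mathfrak l_{(\sigma,\sigma')}$ with $\sigma,\sigma'\in P\cup\{\cdot\}$, where $\sigma,\sigma'$ have no common upper bound if both lie in $P$. Put $\epsilon_{\mathfrak l_{(\sigma,\sigma')}}(\tau)=\mathbf Y$ if $\sigma\le\tau$, $\mathbf N$ if $\sigma'\le\tau$, and $\bot$ otherwise (nothing in $P$ is above $\cdot$). Effects are ordered by $\mathfrak l_{(\sigma_1,\sigma_1')}\le\mathfrak l_{(\sigma_2,\sigma_2')}$ iff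 $\sigma_2\le\sigma_1$ and $\sigma_2'\le\sigma_1'$, with $\cdot$ as largest symbol. Put $\overline{\mathfrak l_{(\sigma,\sigma')}}=\mathfrak l_{(\sigma',\sigma)}$ and $\mathfrak Y=\mathfrak l_{(\bot,\cdot)}$. The real effects of $S$ form the set $\overline E$ of all $\mathfrak l_{(\sigma,\sigma')}$ with $\sigma,\sigma'\in\overline S\setminus\{\bot\}$ and $\sigma^\star\le\sigma'$, all $\mathfrak l_{(\sigma,\cdot)},\mathfrak l_{(\cdot,\sigma)}$ with $\sigma\in\overline S$, and $\mathfrak l_{(\cdot,\cdot)}$. The tensor power $\mathfrak B^{\otimes N}$ consists of the nonempty sets $u\subseteq\mathfrak B^N$, ordered (and identified) through the values $\nu_{l_1\dots l_N}(u)=\bigwedge_{s\in u}\epsilon_{l_1}(s_1)\bullet\dots\bullet\epsilon_{l_N}(s_N)$ for all real effects $l_i$ of $\mathfrak B$; its $i$-th partial trace is $u\mapsto\bigwedge_{s\in u}s_i$. Real effects of $\mathfrak B$ and of $\mathfrak B^{\otimes N}$ are defined as above, all states being real and $\sigma^\star$ being the infimum of the maximal states not above $\sigma$. *Contexts.* Real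 effects $\mathfrak l_1,\dots,\mathfrak l_N$ of $S$ are jointly compatible if there is a map $\Psi:S\to\mathfrak B^{\otimes N}$ preserving binary infima, such that for each real effect $k$ of $\mathfrak B^{\otimes N}$ the map $\epsilon_k\circ\Psi$ equals $\epsilon_{k'}$ for some $k'\in\overline E$, and such that $\epsilon_{\mathfrak l_i}$ is the $i$-th partial trace of $\Psi$ for each $i$. A compatibility context is a set $U\subseteq\overline E$ any finite number of whose elements are jointly compatible. Let $\mathcal C$ be the set of compatibility contexts that are maximal for inclusion. For $\omega$ pure let $C^{(1)}_\omega$ be the set of all $\mathfrak l_{(\sigma,\cdot)}$, $\mathfrak l_{(\cdot,\sigma)}$ with $\sigma\in\overline S$, $\sigma\le\omega$, together with $\mathfrak l_{(\cdot,\cdot)}$. *Empirical model.* A coherent operational description is a family $D=(d^C)_{C\in\mathcal C}$ of maps $d^C:C\to\mathfrak B$ with $d^C(\mathfrak Y)=\mathbf Y$; $d^C(\overline{\mathfrak l})=\overline{d^C(\mathfrak l)}$; $d^C(\bigsqcap_i\mathfrak l_i)=\bigwedge_i d^C(\mathfrak l_i)$ for every nonempty family in $C$ whose infimum in the poset of effects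 of $S$ exists and lies in $C$; and the sheaf condition $d^C(\mathfrak l)=d^{C'}(\mathfrak l)$ for all $\mathfrak l\in C\cap C'$. The empirical model $\mathcal D$ is the set of these families, an inf-semilattice for the pointwise infimum. $D$ is defined globally if there is a real state $\sigma$ with $d^C(\mathfrak l)=\epsilon_{\mathfrak l}(\sigma)$ for all $C\in\mathcal C$, $\mathfrak l\in C$; $\mathcal D$ is contextual if some $D\in\mathcal D$ is not defined globally. For a set $U\subseteq C\in\mathcal C$, the ontic state $\Sigma_D^{U}$ is the real state $\sigma$ with $\epsilon_{\mathfrak l}(\sigma)=d^C(\mathfrak l)$ for all $\mathfrak l\in U$ that is the infimum in $S$ of all real $\tau$ with $\epsilon_{\mathfrak l}(\tau)\ge d^C(\mathfrak l)$ for all $\mathfrak l\in U$. **Theorem.** Every singleton $\{\sigma\}$, $\sigma\in S'$, belongs to $S$; $\mathcal C$ covers $\overline E$; and each $C^{(1)}_\omega$ is contained in some $C\in\mathcal C$. For each $D\in\mathcal D$ and each pure $\omega$ the ontic state $\Sigma_D^{C^{(1)}_\omega}$ exists and does not depend on the $C\in\mathcal C$ containing $C^{(1)}_\omega$; the supremum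 $$\Sigma_D=\bigsqcup_{\omega\text{ pure}}\Sigma_D^{C^{(1)}_\omega}$$ exists in $S$; and $D\mapsto\Sigma_D$ is an isomorphism of inf-semilattices from $\mathcal D$ onto $S$. Moreover $d^C(\mathfrak l)=\epsilon_{\mathfrak l}(\Sigma_D)$ for all $C\in\mathcal C$ and $\mathfrak l\in C$. The state $\Sigma_D$ is hidden if and only if $D$ is not defined globally, and $\mathcal D$ is contextual if and only if $S$ has a hidden state. -/

import Mathlib

namespace Ontic

/-! ### The three-valued boundary domain -/

/-- Counterfactual statements: indeterminate, yes, no. -/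
inductive Outcome : Type
  | bot
  | yes
  | no

namespace Outcome

instance : PartialOrder Outcome where
  le a b := a = bot ∨ a = b
  le_refl a := Or.inr rfl
  le_trans a b c := by
    rintro (h | h) (h' | h')
    · exact Or.inl h
    · exact Or.inl h
    · exact Or.inl (h.trans h')
    · exact Or.inr (h.trans h')
  le_antisymm a b := by
    rintro (h | h) (h' | h')
    · exact h.trans h'.symm
    · exact h'.symm
    · exact h
    · exact h

theorem le_def (a b : Outcome) : a ≤ b ↔ a = bot ∨ a = b := Iff.rfl

/-- The binary infimum. -/
def meet : Outcome → Outcome → Outcome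
  | yes, yes => yes
  | no, no => no
  | _, _ => bot

instance : SemilatticeInf Outcome where
  inf := meet
  inf_le_left a b := by cases a <;> cases b <;> simp [meet, le_def]
  inf_le_right a b := by cases a <;> cases b <;> simp [meet, le_def]
  le_inf a b c := by cases a <;> cases b <;> cases c <;> simp [meet, le_def]

/-- The involution exchanging "yes" and "no". -/
def bar : Outcome → Outcome
  | bot => bot
  | yes => no
  | no => yes

theorem bar_inf (a b : Outcome) : (a ⊓ b).bar = a.bar ⊓ b.bar := by
  cases a <;> cases b <;> rfl

/-- The product `•` of the boundary domain: `x • yes = x`, `x • no = no`, `bot • bot = bot`. -/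
def bullet : Outcome → Outcome → Outcome
  | yes, b => b
  | no, _ => no
  | bot, no => no
  | bot, _ => bot

instance : CommMonoid Outcome where
  mul := bullet
  one := yes
  mul_assoc a b c := by cases a <;> cases b <;> cases c <;> rfl
  one_mul a := rfl
  mul_one a := by cases a <;> rfl
  mul_comm a b := by cases a <;> cases b <;> rfl

open Classical in
/-- The infimum of a nonempty set of outcomes. -/
noncomputable def inf (T : Set Outcome) : Outcome :=
  if T = {yes} then yes else if T = {no} then no else bot

theorem isGLB_inf {T : Set Outcome} (hT : T.Nonempty) : IsGLB T (inf T) := by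
  classical
  unfold inf
  split_ifs with h1 h2
  · rw [h1]; exact isGLB_singleton
  · rw [h2]; exact isGLB_singleton
  · refine ⟨fun a _ => Or.inl rfl, fun b hb => ?_⟩
    rcases eq_or_ne b bot with h | h
    · exact Or.inl h
    · have hT' : T = {b} := by
        ext a
        refine ⟨fun ha => ((hb ha).resolve_left h).symm, ?_⟩
        rintro rfl
        obtain ⟨c, hc⟩ := hT
        rwa [(hb hc).resolve_left h]
      cases b
      · exact absurd rfl h
      · exact absurd hT' h1
      · exact absurd hT' h2

end Outcome

/-! ### Effects -/

/-- The space of effects of a poset `P`.  The effect `l_(σ,σ')` has `pos = σ` and `neg = σ'`;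
the symbol `·` is rendered by `⊤`, so that `⊤ ≤ σ` never holds for `σ : P`. -/
@[ext]
structure Effect (P : Type*) [PartialOrder P] where
  pos : WithTop P
  neg : WithTop P
  no_common_bound : ∀ σ : P, ¬ (pos ≤ (σ : WithTop P) ∧ neg ≤ (σ : WithTop P))

namespace Effect

variable {P : Type*} [PartialOrder P]

/-- The order for which the infimum of effects is computed by taking suprema of both indices
(and `·` when there is no common upper bound). -/
instance : PartialOrder (Effect P) where
  le l l' := l'.pos ≤ l.pos ∧ l'.neg ≤ l.neg
  le_refl l := ⟨le_rfl, le_rfl⟩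
  le_trans l l' l'' h h' := ⟨h'.1.trans h.1, h'.2.trans h.2⟩
  le_antisymm l l' h h' := Effect.ext (le_antisymm h'.1 h.1) (le_antisymm h'.2 h.2)

open Classical in
/-- The evaluation `ε_l(σ)` (also the measurement map `m_l`). -/
noncomputable def eval (l : Effect P) (σ : P) : Outcome :=
  if l.pos ≤ (σ : WithTop P) then Outcome.yes
  else if l.neg ≤ (σ : WithTop P) then Outcome.no
  else Outcome.bot

/-- The conjugate effect. -/
def bar (l : Effect P) : Effect P := ⟨l.neg, l.pos, fun σ h => l.no_common_bound σ h.symm⟩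

/-- `l` is the effect `l_(⊥,·)`. -/
def IsYes (l : Effect P) : Prop := IsBot l.pos ∧ l.neg = ⊤

end Effect

/-! ### Real structures and real effects -/

/-- A set of real states in `P`, and the graph of the star map on them. -/
structure RealData (P : Type*) where
  carrier : Set P
  star : P → P → Prop

namespace RealData

variable {P : Type*} [PartialOrder P]

/-- `l` is a real effect: one of `l_(σ,σ')` with `σ, σ'` real, different from `⊥`, and `σ⋆ ≤ σ'`;
`l_(σ,·)` or `l_(·,σ)` with `σ` real; or `l_(·,·)`. -/
def IsRealEffect (R : RealData P) (l : Effect P) : Prop :=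
  (∃ a ∈ R.carrier, ∃ a' ∈ R.carrier, ¬ IsBot a ∧ ¬ IsBot a' ∧ (∃ b, R.star a b ∧ b ≤ a') ∧
      l.pos = a ∧ l.neg = a') ∨
    (∃ a ∈ R.carrier, l.pos = a ∧ l.neg = ⊤) ∨
    (∃ a ∈ R.carrier, l.pos = ⊤ ∧ l.neg = a) ∨
    (l.pos = ⊤ ∧ l.neg = ⊤)

/-- The pure states: maximal real states. -/
def pure (R : RealData P) : Set P := {ω | Maximal (fun σ => σ ∈ R.carrier) ω}

end RealData

/-- The real structure of a simplex: every state is real, and `σ⋆` is the infimum of the pure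
states that are not above `σ`. -/
def simplexReal (P : Type*) [PartialOrder P] : RealData P where
  carrier := Set.univ
  star a b := IsGLB {ω : P | IsMax ω ∧ ¬ a ≤ ω} b

/-! ### Tensor powers of the boundary domain -/

/-- Representatives of elements of the `n`-th tensor power: nonempty sets `u` of `n`-tuples, to be
thought of as the formal infimum of the pure tensors in `u`. -/
def PreTensor (n : ℕ) : Type := {u : Set (Fin n → Outcome) // u.Nonempty}

namespace PreTensor

variable {n : ℕ}

/-- The value of `u` on the product of the effects `l i`. -/
noncomputable def nu (l : Fin n → Effect Outcome) (u : PreTensor n) : Outcome :=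
  Outcome.inf ((fun s : Fin n → Outcome => ∏ i, (l i).eval (s i)) '' u.1)

instance : Preorder (PreTensor n) where
  le u v := ∀ l : Fin n → Effect Outcome,
    (∀ i, (simplexReal Outcome).IsRealEffect (l i)) → nu l u ≤ nu l v
  le_refl u l _ := le_rfl
  le_trans u v w h h' l hl := (h l hl).trans (h' l hl)

/-- The infimum of the `i`-th components. -/
noncomputable def trace (i : Fin n) (u : PreTensor n) : Outcome :=
  Outcome.inf ((fun s : Fin n → Outcome => s i) '' u.1)

theorem trace_mono (i : Fin n) {u v : PreTensor n} (h : u ≤ v) :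
    trace i u ≤ trace i v := by
  classical
  have hyn : ∀ a b : Outcome, ((a : WithTop Outcome) ≤ (b : WithTop Outcome)) ↔
      (a = .bot ∨ a = b) := fun a b => WithTop.coe_le_coe
  let lyn : Effect Outcome := ⟨(Outcome.yes : Outcome), (Outcome.no : Outcome), by
    intro σ; rw [hyn, hyn]; cases σ <;> simp⟩
  let ly : Effect Outcome := ⟨(Outcome.bot : Outcome), ⊤, by intro σ; simp⟩
  have e1 : ∀ σ, lyn.eval σ = σ := by
    intro σ
    simp only [Effect.eval, lyn, hyn]
    cases σ <;> simp
  have e2 : ∀ σ, ly.eval σ = 1 := by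
    intro σ
    simp only [Effect.eval, ly, hyn]
    cases σ <;> rfl
  let l : Fin n → Effect Outcome := fun j => if j = i then lyn else ly
  have hl : ∀ j, (simplexReal Outcome).IsRealEffect (l j) := by
    intro j
    by_cases hj : j = i
    · have : l j = lyn := if_pos hj
      rw [this]
      refine Or.inl ⟨.yes, trivial, .no, trivial, ?_, ?_, ⟨.no, ?_, le_rfl⟩, rfl, rfl⟩
      · intro hb
        have := hb .no
        simp [Outcome.le_def] at this
      · intro hb
        have := hb .yes
        simp [Outcome.le_def] at this
      · have hs : {ω : Outcome | IsMax ω ∧ ¬ Outcome.yes ≤ ω} = {Outcome.no} := by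
          ext ω
          simp only [Set.mem_ofPred_eq, Set.mem_singleton_iff]
          constructor
          · rintro ⟨h1, h2⟩
            cases ω
            · have := h1 (b := .yes) (Or.inl rfl)
              simp [Outcome.le_def] at this
            · exact absurd le_rfl h2
            · rfl
          · rintro rfl
            refine ⟨fun b hb => ?_, ?_⟩
            · rcases hb with hb | hb
              · simp at hb
              · exact Or.inr hb.symm
            · simp [Outcome.le_def]
        change IsGLB {ω : Outcome | IsMax ω ∧ ¬ Outcome.yes ≤ ω} Outcome.no
        rw [hs]
        exact isGLB_singleton
    · have : l j = ly := if_neg hj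
      rw [this]
      exact Or.inr (Or.inl ⟨.bot, trivial, rfl, rfl⟩)
  have key : ∀ w : PreTensor n, nu l w = trace i w := by
    intro w
    unfold nu trace
    congr 1
    refine Set.image_congr fun s _ => ?_
    rw [Finset.prod_eq_single i]
    · simp [l, e1]
    · intro j _ hj
      simp [l, hj, e2]
    · simp
  have := h l hl
  rwa [key, key] at this

end PreTensor

/-- The `n`-th tensor power of the boundary domain: nonempty sets of tuples, modulo equality of
the values on all products of real effects. -/
abbrev TensorPower (n : ℕ) : Type := Antisymmetrization (PreTensor n) (· ≤ ·)

/-- The `i`-th partial trace of the tensor power onto the boundary domain. -/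
noncomputable def partialTrace {n : ℕ} (i : Fin n) : TensorPower n → Outcome :=
  Quotient.lift (PreTensor.trace i) fun _ _ h =>
    le_antisymm (PreTensor.trace_mono i h.1) (PreTensor.trace_mono i h.2)

/-! ### Compatibility, contexts, empirical models -/

section Contextuality

variable {P : Type*} [PartialOrder P]

/-- The measurements of the real effects `l 0, …, l (n-1)` are jointly compatible: there is a
joint morphism `Ψ` to the tensor power which preserves binary infima, pulls real effects back to
real effects, and whose partial traces are the given measurements. -/
def JointlyCompatible (R : RealData P) {n : ℕ} (l : Fin n → Effect P) : Prop :=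
  ∃ Ψ : P → TensorPower n,
    (∀ σ₁ σ₂ σ : P, IsGLB {σ₁, σ₂} σ → IsGLB {Ψ σ₁, Ψ σ₂} (Ψ σ)) ∧
    (∀ k : Effect (TensorPower n), (simplexReal (TensorPower n)).IsRealEffect k →
      ∃ k' : Effect P, R.IsRealEffect k' ∧ ∀ σ, k'.eval σ = k.eval (Ψ σ)) ∧
    ∀ i σ, (l i).eval σ = partialTrace i (Ψ σ)

/-- A compatibility context: a set of real effects, any finite number of which have jointly
compatible measurements. -/
def IsContext (R : RealData P) (U : Set (Effect P)) : Prop :=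
  (∀ l ∈ U, R.IsRealEffect l) ∧
    ∀ (n : ℕ) (l : Fin n → Effect P), (∀ i, l i ∈ U) → JointlyCompatible R l

/-- The compatibility cover: all the compatibility contexts that are maximal for inclusion. -/
def cover (R : RealData P) : Set (Set (Effect P)) := {C | Maximal (IsContext R) C}

/-- The compatibility context attached to a pure state `ω`: the effects `l_(σ,·)` and `l_(·,σ)`
with `σ` real and `σ ≤ ω`, and `l_(·,·)`. -/
def contextOne (R : RealData P) (ω : P) : Set (Effect P) :=
  {l | (∃ σ ∈ R.carrier, σ ≤ ω ∧ l.pos = σ ∧ l.neg = ⊤) ∨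
    (∃ σ ∈ R.carrier, σ ≤ ω ∧ l.pos = ⊤ ∧ l.neg = σ) ∨ (l.pos = ⊤ ∧ l.neg = ⊤)}

/-- Operational descriptions: an outcome for every effect of every maximal context, compatible
with the unit effect, with conjugation, and with the infima taken in the space of effects. -/
@[ext]
structure OperationalDescription (R : RealData P) where
  d : ∀ C : cover R, ↥C.1 → Outcome
  d_yes : ∀ (C : cover R) (l : ↥C.1), l.1.IsYes → d C l = Outcome.yes
  d_bar : ∀ (C : cover R) (l l' : ↥C.1), l'.1 = l.1.bar → d C l' = (d C l).bar
  d_inf : ∀ (C : cover R) (L : Set ↥C.1) (l : ↥C.1),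
    L.Nonempty → IsGLB (Subtype.val '' L) l.1 → IsGLB (d C '' L) (d C l)

/-- The empirical model: coherent operational descriptions, i.e. those satisfying the
sheaf condition. -/
@[ext]
structure EmpiricalModel (R : RealData P) extends OperationalDescription R where
  coherent : ∀ (C C' : cover R) (l : Effect P) (h : l ∈ C.1) (h' : l ∈ C'.1),
    d C ⟨l, h⟩ = d C' ⟨l, h'⟩

namespace EmpiricalModel

variable {R : RealData P}

/-- The pointwise infimum. -/
def inf (D₁ D₂ : EmpiricalModel R) : EmpiricalModel R where
  d C l := D₁.d C l ⊓ D₂.d C l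
  d_yes C l h := by rw [D₁.d_yes C l h, D₂.d_yes C l h, inf_idem]
  d_bar C l l' h := by rw [D₁.d_bar C l l' h, D₂.d_bar C l l' h, Outcome.bar_inf]
  d_inf C L l hL hl := by
    have h₁ := D₁.d_inf C L l hL hl
    have h₂ := D₂.d_inf C L l hL hl
    refine ⟨?_, fun b hb => le_inf (h₁.2 ?_) (h₂.2 ?_)⟩
    · rintro _ ⟨k, hk, rfl⟩
      exact inf_le_inf (h₁.1 ⟨k, hk, rfl⟩) (h₂.1 ⟨k, hk, rfl⟩)
    · rintro _ ⟨k, hk, rfl⟩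
      exact (hb ⟨k, hk, rfl⟩).trans inf_le_left
    · rintro _ ⟨k, hk, rfl⟩
      exact (hb ⟨k, hk, rfl⟩).trans inf_le_right
  coherent C C' l h h' := by rw [D₁.coherent C C' l h h', D₂.coherent C C' l h h']

instance : SemilatticeInf (EmpiricalModel R) where
  le D₁ D₂ := ∀ C l, D₁.d C l ≤ D₂.d C l
  le_refl D C l := le_rfl
  le_trans D₁ D₂ D₃ h h' C l := (h C l).trans (h' C l)
  le_antisymm D₁ D₂ h h' :=
    EmpiricalModel.ext (funext fun C => funext fun l => le_antisymm (h C l) (h' C l))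
  inf := inf
  inf_le_left D₁ D₂ C l := inf_le_left (a := D₁.d C l)
  inf_le_right D₁ D₂ C l := inf_le_right (a := D₁.d C l)
  le_inf D₁ D₂ D₃ h h' C l := le_inf (h C l) (h' C l)

/-- `D` is given by the evaluations on one real state. -/
def DefinedGlobally (D : EmpiricalModel R) : Prop :=
  ∃ σ ∈ R.carrier, ∀ (C : cover R) (l : ↥C.1), D.d C l = l.1.eval σ

/-- `σ` is the ontic state associated to the restriction of `D` to the context `U`, where `U` is
contained in the maximal context `C`: it is real, reproduces the outcomes attributed by `D` on
`U`, and is the infimum of all the real states returning at least these outcomes. -/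
def IsOnticState (D : EmpiricalModel R) (C : cover R) (U : Set (Effect P)) (hU : U ⊆ C.1)
    (σ : P) : Prop :=
  σ ∈ R.carrier ∧ (∀ (l : Effect P) (hl : l ∈ U), l.eval σ = D.d C ⟨l, hU hl⟩) ∧
    IsGLB {τ : P | τ ∈ R.carrier ∧ ∀ (l : Effect P) (hl : l ∈ U),
      D.d C ⟨l, hU hl⟩ ≤ l.eval τ} σ

end EmpiricalModel

/-- Every coherent operational description is defined globally. -/
def NonContextual (R : RealData P) : Prop := ∀ D : EmpiricalModel R, D.DefinedGlobally

end Contextuality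

/-! ### Ontic completion -/

section Completion

variable {S : Type*} [PartialOrder S] [OrderBot S]

/-- The axioms on `(S', ⋆)`: nonempty infima exist, every state is the infimum of the maximal
states above it, and `⋆` is an order-reversing involution of `S' \ {⊥}` such that `σ` and `σ⋆`
have no common upper bound.  The value of `star` at `⊥` is irrelevant. -/
structure IsStarSpace (star : S → S) : Prop where
  exists_inf : ∀ U : Set S, U.Nonempty → ∃ σ, IsGLB U σ
  generated : ∀ σ : S, IsGLB {ω | IsMax ω ∧ σ ≤ ω} σ
  star_ne_bot : ∀ σ, σ ≠ ⊥ → star σ ≠ ⊥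
  star_star : ∀ σ, σ ≠ ⊥ → star (star σ) = σ
  star_anti : ∀ σ τ, σ ≠ ⊥ → τ ≠ ⊥ → σ ≤ τ → star τ ≤ star σ
  star_unbounded : ∀ σ, σ ≠ ⊥ → ¬ BddAbove {σ, star σ}

/-- The preorder `⊑` on sets of states. -/
def SetLe {T : Type*} [PartialOrder T] (U V : Set T) : Prop := ∀ σ ∈ U, ∃ τ ∈ V, σ ≤ τ

/-- The Finite Rank Condition. -/
def FiniteRank (T : Type*) [PartialOrder T] : Prop :=
  ∀ U : Set T, BddAbove U → ∃ V : Set T, V.Finite ∧ SetLe V U ∧ ∃ σ, IsLUB U σ ∧ IsLUB V σ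

/-- The pre-closure: the maximal elements among the suprema of the bounded sets `V ⊑ U`. -/
def preClosure (U : Set S) : Set S := {σ | Maximal (fun τ => ∃ V, SetLe V U ∧ IsLUB V τ) σ}

/-- The closure `cl_c`: the supremum of the iterates of the pre-closure, i.e. the set of maximal
elements of their union. -/
def closureC (U : Set S) : Set S := {σ | Maximal (fun τ => ∃ n : ℕ, τ ∈ preClosure^[n + 1] U) σ}

/-- The sets of non-bottom states containing no `σ, σ'` with `σ⋆ ≤ σ'`. -/
def consistentSets (star : S → S) : Set (Set S) :=
  {U | ⊥ ∉ U ∧ ∀ σ ∈ U, ∀ σ' ∈ U, ¬ star σ ≤ σ'}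

/-- The admissible sets `Q_c`. -/
def admissibleSets (star : S → S) : Set (Set S) :=
  {U | ⊥ ∉ U ∧ closureC U ∈ consistentSets star} ∪ {{⊥}}

/-- The maximal ontic completion of `(S', ⋆)`: the closures of the admissible sets. -/
def OnticCompletion (star : S → S) : Type _ := {J : Set S // J ∈ closureC '' admissibleSets star}

theorem OnticCompletion.subset_of_le {star : S → S} {J K : OnticCompletion star}
    (h : SetLe J.1 K.1) (h' : SetLe K.1 J.1) : J.1 ⊆ K.1 := by
  obtain ⟨U, _, hU⟩ := J.2
  intro σ hσ
  obtain ⟨τ, hτ, hστ⟩ := h σ hσ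
  obtain ⟨ρ, hρ, hτρ⟩ := h' τ hτ
  have hσ' : σ ∈ closureC U := hU.symm ▸ hσ
  have hρ' : ρ ∈ closureC U := hU.symm ▸ hρ
  have : ρ ≤ σ := hσ'.2 hρ'.1 (hστ.trans hτρ)
  have e : σ = τ := le_antisymm hστ (hτρ.trans this)
  rwa [e]

instance (star : S → S) : PartialOrder (OnticCompletion star) where
  le J K := SetLe J.1 K.1
  le_refl J σ hσ := ⟨σ, hσ, le_rfl⟩
  le_trans J K L h h' σ hσ := by
    obtain ⟨τ, hτ, h1⟩ := h σ hσ
    obtain ⟨ρ, hρ, h2⟩ := h' τ hτ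
    exact ⟨ρ, hρ, h1.trans h2⟩
  le_antisymm J K h h' := Subtype.ext (Set.Subset.antisymm
    (OnticCompletion.subset_of_le h h') (OnticCompletion.subset_of_le h' h))

/-- The real structure of the ontic completion: the real states are the singletons `{σ}`, and
`{σ}⋆ = {σ⋆}`. -/
def onticReal (star : S → S) : RealData (OnticCompletion star) where
  carrier := {J | ∃ σ : S, J.1 = {σ}}
  star J K := ∃ σ : S, σ ≠ ⊥ ∧ J.1 = {σ} ∧ K.1 = {star σ}

/-- Hidden states: the states of the completion that are not real. -/
def hiddenStates (star : S → S) : Set (OnticCompletion star) := (onticReal star).carrierᶜ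

end Completion

end Ontic

namespace Ontic

/-! ### Outcomes and evaluations -/

/-! The finite rank condition and the bound on chains give `S'` the ascending chain condition
(`FiniteRank.wellFoundedGT`). A state of the completion is then the same thing as a lower set of
`S'` closed under existing suprema (`IsSupIdeal`) and containing no nonbottom `σ`, `τ` with `σ⋆ ≤
τ`: one passes to the lower closure in one direction and to the maximal elements in the other, and
`⊑` becomes inclusion.

A coherent description `D` produces such a set, namely the `σ` for which `l_(σ,·)` gets the outcome
"yes" (`yesIdeal`). It is an ideal because `l_(⊔V,·)` is the infimum of the `l_(τ,·)`, `τ ∈ V`, and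
it is consistent because `σ⋆ ≤ τ` would make `l_(σ,τ)` a real effect with outcomes both "yes" and
"no". This set determines `D`, since `l_(σ,·)` is the infimum of `l_(σ,σ')` and the unit effect,
while conjugation recovers the outcome "no". Conversely, evaluation on any state is coherent. Hence
descriptions and states correspond, and real states correspond to globally defined descriptions.

These relations are only available inside a single context, so enough contexts are needed. They come
from maps to a simplex: given indices `s w`, send `σ` to the infimum of the vertices `w` with `¬ s w
≤ σ` (`IsSeparating.isContext`). Two such families suffice, one attached to a single effect and one
to the states under a given real state.

The ontic state at `ω` is the greatest element of `yesIdeal` under `ω`. Since every state of `S'` is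
under a maximal one, these elements generate the ideal. -/

theorem Outcome.ext_yes_no {a b : Outcome} (hy : a = yes ↔ b = yes) (hn : a = no ↔ b = no) :
    a = b := by
  cases a <;> cases b <;> simp_all

theorem Outcome.yes_le_iff {a : Outcome} : yes ≤ a ↔ a = yes := by
  cases a <;> simp [Outcome.le_def]

theorem Outcome.no_le_iff {a : Outcome} : no ≤ a ↔ a = no := by
  cases a <;> simp [Outcome.le_def]

theorem Outcome.le_of_yes_no {a b : Outcome} (hy : a = yes → b = yes) (hn : a = no → b = no) :
    a ≤ b := by
  cases a <;> cases b <;> simp_all [Outcome.le_def]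

theorem Outcome.isGLB_iff {T : Set Outcome} (hT : T.Nonempty) {a : Outcome} :
    IsGLB T a ↔ (a = yes ↔ ∀ b ∈ T, b = yes) ∧ (a = no ↔ ∀ b ∈ T, b = no) := by
  constructor
  · intro h
    refine ⟨?_, ?_⟩
    · rw [← yes_le_iff, le_isGLB_iff h]
      exact forall₂_congr fun b _ => yes_le_iff
    · rw [← no_le_iff, le_isGLB_iff h]
      exact forall₂_congr fun b _ => no_le_iff
  · rintro ⟨hy, hn⟩
    have h := isGLB_inf hT
    have e : inf T = a := by
      apply ext_yes_no
      · rw [hy, ← yes_le_iff, le_isGLB_iff h]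
        exact forall₂_congr fun b _ => yes_le_iff
      · rw [hn, ← no_le_iff, le_isGLB_iff h]
        exact forall₂_congr fun b _ => no_le_iff
    rwa [e] at h

namespace Effect

variable {P : Type*} [PartialOrder P]

theorem eval_eq_yes_iff (l : Effect P) (σ : P) :
    l.eval σ = Outcome.yes ↔ l.pos ≤ (σ : WithTop P) := by
  unfold eval
  split_ifs <;> simp_all

theorem eval_eq_no_iff (l : Effect P) (σ : P) :
    l.eval σ = Outcome.no ↔ l.neg ≤ (σ : WithTop P) := by
  have := l.no_common_bound σ
  unfold eval
  split_ifs <;> simp_all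

theorem eval_mono (l : Effect P) {σ τ : P} (h : σ ≤ τ) : l.eval σ ≤ l.eval τ := by
  apply Outcome.le_of_yes_no
  · simp only [eval_eq_yes_iff]
    exact fun h' => h'.trans (WithTop.coe_le_coe.2 h)
  · simp only [eval_eq_no_iff]
    exact fun h' => h'.trans (WithTop.coe_le_coe.2 h)

theorem eval_bar (l : Effect P) (σ : P) : l.bar.eval σ = (l.eval σ).bar := by
  apply Outcome.ext_yes_no
  · have : (l.eval σ).bar = Outcome.yes ↔ l.eval σ = Outcome.no := by
      cases l.eval σ <;> simp [Outcome.bar]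
    rw [this, eval_eq_yes_iff, eval_eq_no_iff]
    rfl
  · have : (l.eval σ).bar = Outcome.no ↔ l.eval σ = Outcome.yes := by
      cases l.eval σ <;> simp [Outcome.bar]
    rw [this, eval_eq_yes_iff, eval_eq_no_iff]
    rfl

/-- If every effect of `L` says "yes" at `σ`, then `l_(σ,·)` is a lower bound of `L`, hence below
`l`, which therefore says "yes" too; `l_(·,σ)` plays the same role for "no". No formula for infima
of effects is needed. -/
theorem eval_isGLB {L : Set (Effect P)} (hL : L.Nonempty) {l : Effect P} (h : IsGLB L l) (σ : P) :
    IsGLB ((fun k => k.eval σ) '' L) (l.eval σ) := by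
  rw [Outcome.isGLB_iff (hL.image _)]
  simp only [Set.forall_mem_image, eval_eq_yes_iff, eval_eq_no_iff]
  refine ⟨⟨fun hl k hk => (h.1 hk).1.trans hl, fun hk => ?_⟩,
    fun hl k hk => (h.1 hk).2.trans hl, fun hk => ?_⟩
  · let m : Effect P := ⟨σ, ⊤, fun τ => by simp⟩
    have : m ≤ l := h.2 fun k hk' => ⟨hk hk', le_top⟩
    exact this.1
  · let m : Effect P := ⟨⊤, σ, fun τ => by simp⟩
    have : m ≤ l := h.2 fun k hk' => ⟨le_top, hk hk'⟩
    exact this.2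

end Effect

/-! ### Tensor powers -/

namespace PreTensor

variable {n : ℕ}

/-- The pure tensor given by a tuple. -/
def ofTuple (s : Fin n → Outcome) : PreTensor n := ⟨{s}, Set.singleton_nonempty s⟩

/-- Each value on `u` is by definition the infimum of the values on the tuples of `u`, so `u`
behaves as the infimum of its pure tensors. -/
theorem le_iff_forall_ofTuple {u v : PreTensor n} : v ≤ u ↔ ∀ s ∈ u.1, v ≤ ofTuple s := by
  have key : ∀ l : Fin n → Effect Outcome,
      nu l v ≤ nu l u ↔ ∀ s ∈ u.1, nu l v ≤ nu l (ofTuple s) := by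
    intro l
    have h1 : ∀ s, nu l (ofTuple s) = ∏ i, (l i).eval (s i) := by
      intro s
      have := Outcome.isGLB_inf (((ofTuple s).2).image
        (fun s : Fin n → Outcome => ∏ i, (l i).eval (s i)))
      refine this.unique ?_
      rw [ofTuple, Set.image_singleton]
      exact isGLB_singleton
    simp only [h1]
    rw [le_isGLB_iff (show IsGLB _ (nu l u) from Outcome.isGLB_inf (u.2.image _))]
    exact Set.forall_mem_image
  constructor
  · intro h s hs l hl
    exact (key l).1 (h l hl) s hs
  · intro h l hl
    exact (key l).2 fun s hs => h s hs l hl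

end PreTensor

theorem TensorPower.le_mk_iff {n : ℕ} (a : TensorPower n) (u : PreTensor n) :
    a ≤ toAntisymmetrization (· ≤ ·) u ↔
      ∀ s ∈ u.1, a ≤ toAntisymmetrization (· ≤ ·) (PreTensor.ofTuple s) := by
  induction a using Quotient.inductionOn with
  | h v => exact PreTensor.le_iff_forall_ofTuple

/-! ### Joint compatibility from families of indices -/

section Context

variable {P : Type*} [PartialOrder P]

/-- A family of indices which determines a morphism to a simplex on `Ω`: the image of `σ` is the
infimum of the vertices `w` with `¬ s w ≤ σ`. -/
structure IsSeparating (R : RealData P) {Ω : Type*} (s : Ω → WithTop P) : Prop where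
  exists_not_le : ∀ σ : P, ∃ w, ¬ s w ≤ σ
  exists_sup : ∀ B : Set Ω, ∃ m : WithTop P, (m = ⊤ ∨ ∃ a ∈ R.carrier, m = a) ∧
    ∀ σ : P, m ≤ σ ↔ ∀ w ∈ B, s w ≤ σ
  star_le : ∀ B B' : Set Ω, B ∪ B' = Set.univ → ∀ a ∈ R.carrier, ∀ a' ∈ R.carrier,
    ¬ IsBot a → ¬ IsBot a' → (∀ σ : P, a ≤ σ ↔ ∀ w ∈ B, s w ≤ σ) →
    (∀ σ : P, a' ≤ σ ↔ ∀ w ∈ B', s w ≤ σ) → ∃ b, R.star a b ∧ b ≤ a'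

/-- `g` represents the measurement of `l` on the simplex determined by `s`. -/
def Represents {Ω : Type*} (s : Ω → WithTop P) (g : Ω → Outcome) (l : Effect P) : Prop :=
  (∀ σ : P, l.pos ≤ σ ↔ ∀ w, g w ≠ .yes → s w ≤ σ) ∧
    ∀ σ : P, l.neg ≤ σ ↔ ∀ w, g w ≠ .no → s w ≤ σ

/-- The real effects whose measurements factor through the simplex determined by `s`. -/
def contextOf (R : RealData P) {Ω : Type*} (s : Ω → WithTop P) : Set (Effect P) :=
  {l | R.IsRealEffect l ∧ ∃ g : Ω → Outcome, Represents s g l}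

namespace IsSeparating

variable {R : RealData P} {Ω : Type*} {s : Ω → WithTop P}

/-- The vertices under `σ`, seen in the tensor power. -/
def toPreTensor (hs : IsSeparating R s) {n : ℕ} (f : Ω → Fin n → Outcome) (σ : P) : PreTensor n :=
  ⟨f '' {w | ¬ s w ≤ σ}, Set.Nonempty.image f (hs.exists_not_le σ)⟩

/-- An element `p` is below the image of `σ` exactly when every vertex not above `p` has been
discarded, that is, has index below `σ`. So `p` pulls back to the supremum of the indices of those
vertices. -/
theorem exists_pullback (hs : IsSeparating R s) {n : ℕ} (f : Ω → Fin n → Outcome)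
    (k : Effect (TensorPower n)) :
    ∃ k' : Effect P, R.IsRealEffect k' ∧
      ∀ σ, k'.eval σ = k.eval (toAntisymmetrization (· ≤ ·) (hs.toPreTensor f σ)) := by
  let v : Ω → TensorPower n := fun w => toAntisymmetrization (· ≤ ·) (PreTensor.ofTuple (f w))
  have key : ∀ (p : WithTop (TensorPower n)) (σ : P),
      p ≤ (toAntisymmetrization (· ≤ ·) (hs.toPreTensor f σ) : TensorPower n) ↔
        ∀ w ∈ {w | ¬ p ≤ v w}, s w ≤ σ := by
    intro p σ
    induction p using WithTop.recTopCoe with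
    | top =>
      obtain ⟨w, hw⟩ := hs.exists_not_le σ
      simp only [top_le_iff, WithTop.coe_ne_top, not_false_eq_true, Set.mem_ofPred_eq, forall_true_left,
        false_iff]
      exact fun h => hw (h w)
    | coe a =>
      simp only [WithTop.coe_le_coe, Set.mem_ofPred_eq]
      rw [TensorPower.le_mk_iff]
      simp only [toPreTensor, Set.forall_mem_image, Set.mem_ofPred_eq]
      exact forall_congr' fun w => not_imp_comm
  obtain ⟨m, hm, hm'⟩ := hs.exists_sup {w | ¬ k.pos ≤ v w}
  obtain ⟨q, hq, hq'⟩ := hs.exists_sup {w | ¬ k.neg ≤ v w}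
  have hno : ∀ σ : P, ¬ (m ≤ (σ : WithTop P) ∧ q ≤ (σ : WithTop P)) := by
    rintro σ ⟨h1, h2⟩
    rw [hm', ← key] at h1
    rw [hq', ← key] at h2
    exact k.no_common_bound _ ⟨h1, h2⟩
  refine ⟨⟨m, q, hno⟩, ?_, fun σ => ?_⟩
  · rcases hm with rfl | ⟨a, ha, rfl⟩ <;> rcases hq with rfl | ⟨a', ha', rfl⟩
    · exact Or.inr (Or.inr (Or.inr ⟨rfl, rfl⟩))
    · exact Or.inr (Or.inr (Or.inl ⟨a', ha', rfl, rfl⟩))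
    · exact Or.inr (Or.inl ⟨a, ha, rfl, rfl⟩)
    · have hb : ¬ IsBot a := fun h => hno a' ⟨WithTop.coe_le_coe.2 (h a'), le_rfl⟩
      have hb' : ¬ IsBot a' := fun h => hno a ⟨le_rfl, WithTop.coe_le_coe.2 (h a)⟩
      refine Or.inl ⟨a, ha, a', ha', hb, hb', ?_, rfl, rfl⟩
      refine hs.star_le _ _ ?_ a ha a' ha' hb hb'
        (fun σ => by rw [← hm', WithTop.coe_le_coe]) (fun σ => by rw [← hq', WithTop.coe_le_coe])
      -- No vertex is above both `k.pos` and `k.neg`, so the two sets of discarded vertices cover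
      -- `Ω`, as `star_le` demands.
      ext w
      have := k.no_common_bound (v w)
      simp only [Set.mem_union, Set.mem_ofPred_eq, Set.mem_univ, iff_true]
      tauto
  · apply Outcome.ext_yes_no
    · rw [Effect.eval_eq_yes_iff, Effect.eval_eq_yes_iff, key, ← hm']
    · rw [Effect.eval_eq_no_iff, Effect.eval_eq_no_iff, key, ← hq']

theorem isGLB_toPreTensor (hs : IsSeparating R s) {n : ℕ} (f : Ω → Fin n → Outcome)
    {σ₁ σ₂ σ : P} (h : IsGLB {σ₁, σ₂} σ) :
    IsGLB {(toAntisymmetrization (· ≤ ·) (hs.toPreTensor f σ₁) : TensorPower n),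
      toAntisymmetrization (· ≤ ·) (hs.toPreTensor f σ₂)}
      (toAntisymmetrization (· ≤ ·) (hs.toPreTensor f σ)) := by
  -- The vertices kept by `σ` are thus the union of those kept by `σ₁` and `σ₂`, and a union of sets
  -- of tuples represents an infimum.
  have hw : ∀ w, s w ≤ σ ↔ s w ≤ σ₁ ∧ s w ≤ σ₂ := by
    intro w
    obtain ⟨m, hm, hm'⟩ := hs.exists_sup {w}
    simp only [Set.mem_singleton_iff, forall_eq] at hm'
    rw [← hm', ← hm', ← hm']
    rcases hm with rfl | ⟨a, _, rfl⟩
    · simp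
    · simp only [WithTop.coe_le_coe]
      rw [le_isGLB_iff h]
      simp [lowerBounds]
  have key : ∀ a : TensorPower n, a ≤ toAntisymmetrization (· ≤ ·) (hs.toPreTensor f σ) ↔
      a ≤ toAntisymmetrization (· ≤ ·) (hs.toPreTensor f σ₁) ∧
        a ≤ toAntisymmetrization (· ≤ ·) (hs.toPreTensor f σ₂) := by
    intro a
    rw [TensorPower.le_mk_iff, TensorPower.le_mk_iff, TensorPower.le_mk_iff]
    simp only [toPreTensor, Set.forall_mem_image, Set.mem_ofPred_eq, hw, ← forall_and]
    refine forall_congr' fun w => ?_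
    tauto
  have h0 := (key _).1 le_rfl
  refine ⟨?_, fun b hb => (key b).2 ⟨hb (by simp), hb (by simp)⟩⟩
  rintro _ (rfl | rfl)
  · exact h0.1
  · exact h0.2

/-- The outcome functions representing the given effects serve as coordinates of the vertices. The
`i`-th trace at `σ` is "yes" when every vertex of another value has index below `σ`, which is what
`Represents` says. -/
theorem isContext (hs : IsSeparating R s) : IsContext R (contextOf R s) := by
  refine ⟨fun l hl => hl.1, fun n l hl => ?_⟩
  choose g hg using fun i => (hl i).2
  refine ⟨fun σ => toAntisymmetrization (· ≤ ·) (hs.toPreTensor (fun w i => g i w) σ),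
    fun σ₁ σ₂ σ h => hs.isGLB_toPreTensor _ h, fun k _ => hs.exists_pullback _ k, fun i σ => ?_⟩
  change (l i).eval σ = PreTensor.trace i (hs.toPreTensor (fun w i => g i w) σ)
  have hT := (hs.toPreTensor (fun w i => g i w) σ).2.image (fun t : Fin n → Outcome => t i)
  have h := (Outcome.isGLB_iff hT).1 (Outcome.isGLB_inf hT)
  unfold PreTensor.trace
  apply Outcome.ext_yes_no
  · rw [h.1, Effect.eval_eq_yes_iff, (hg i).1]
    simp only [toPreTensor, Set.forall_mem_image, Set.mem_ofPred_eq]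
    exact forall_congr' fun w => not_imp_comm
  · rw [h.2, Effect.eval_eq_no_iff, (hg i).2]
    simp only [toPreTensor, Set.forall_mem_image, Set.mem_ofPred_eq]
    exact forall_congr' fun w => not_imp_comm

end IsSeparating

/-- Being a context is a condition on finite subfamilies, so it passes to unions of chains and
Zorn's lemma applies. -/
theorem IsContext.exists_mem_cover {R : RealData P} {U : Set (Effect P)} (hU : IsContext R U) :
    ∃ C ∈ cover R, U ⊆ C := by
  obtain ⟨C, hUC, hC⟩ := zorn_subset_nonempty {U | IsContext R U} (fun c hc hchain hne => by
    refine ⟨⋃₀ c, ⟨fun l ⟨V, hV, hl⟩ => (hc hV).1 l hl, fun n l hl => ?_⟩,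
      fun V hV => Set.subset_sUnion_of_mem hV⟩
    have : ∃ V ∈ c, ∀ i, l i ∈ V := by
      obtain ⟨V, hV, h⟩ := hchain.directedOn.exists_mem_subset_of_finite_of_subset_sUnion hne
        (Set.finite_range l) (Set.range_subset_iff.2 hl)
      exact ⟨V, hV, fun i => h ⟨i, rfl⟩⟩
    obtain ⟨V, hV, h⟩ := this
    exact (hc hV).2 n l h) U hU
  exact ⟨C, hC, hUC⟩

end Context

/-! ### Ideals of states -/

section Ideals

variable {S : Type*} [PartialOrder S]

/-- The supremum of an increasing sequence is already the supremum of finitely many elements, each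
below some term, so it is attained at a term. -/
theorem FiniteRank.wellFoundedGT (hrank : FiniteRank S)
    (hchain : ∀ c : Set S, IsChain (· ≤ ·) c → BddAbove c) : WellFoundedGT S := by
  rw [wellFoundedGT_iff_monotone_chain_condition]
  intro f
  obtain ⟨V, hV, hVf, σ, h1, h2⟩ := hrank (Set.range f) (hchain _ f.monotone.isChain_range)
  have : ∀ v ∈ V, ∃ n, v ≤ f n := fun v hv => by
    obtain ⟨_, ⟨n, rfl⟩, h⟩ := hVf v hv
    exact ⟨n, h⟩
  choose! n hn using this
  obtain ⟨N, hN⟩ := (hV.image n).bddAbove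
  have hσ : σ ≤ f N := h2.2 fun v hv => (hn v hv).trans (f.monotone (hN ⟨v, hv, rfl⟩))
  exact ⟨N, fun m hm => le_antisymm (f.monotone hm) ((h1.1 ⟨m, rfl⟩).trans hσ)⟩

/-- Lower sets which are closed under the suprema of bounded sets. -/
structure IsSupIdeal (I : Set S) : Prop where
  isLowerSet : IsLowerSet I
  lub_mem : ∀ V ⊆ I, ∀ σ, IsLUB V σ → σ ∈ I

theorem isSupIdeal_Iic (σ : S) : IsSupIdeal (Set.Iic σ) :=
  ⟨isLowerSet_Iic σ, fun _ hV _ h => h.2 hV⟩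

theorem IsSupIdeal.mem_of_setLe {I : Set S} (hI : IsSupIdeal I) {U V : Set S} (hU : U ⊆ I)
    (hV : SetLe V U) {σ : S} (h : IsLUB V σ) : σ ∈ I := by
  refine hI.lub_mem V (fun v hv => ?_) σ h
  obtain ⟨u, hu, hvu⟩ := hV v hv
  exact hI.isLowerSet hvu (hU hu)

theorem IsSupIdeal.lowerClosure_maximal [WellFoundedGT S] {I : Set S} (hI : IsSupIdeal I) :
    (lowerClosure {σ | Maximal (· ∈ I) σ} : Set S) = I := by
  ext σ
  simp only [SetLike.mem_coe, mem_lowerClosure]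
  constructor
  · rintro ⟨τ, hτ, h⟩
    exact hI.isLowerSet h hτ.1
  · intro h
    obtain ⟨τ, hτ, h⟩ := exists_maximal_ge_of_wellFoundedGT (· ∈ I) σ h
    exact ⟨τ, h, hτ⟩

theorem lowerClosure_le_preClosure [WellFoundedGT S] (U : Set S) :
    lowerClosure U ≤ lowerClosure (preClosure U) := by
  rintro σ ⟨τ, hτ, hστ⟩
  obtain ⟨ρ, h, hρ⟩ := exists_maximal_ge_of_wellFoundedGT (fun τ => ∃ V, SetLe V U ∧ IsLUB V τ) τ
    ⟨{τ}, by rintro _ rfl; exact ⟨_, hτ, le_rfl⟩, isLUB_singleton⟩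
  exact ⟨ρ, hρ, hστ.trans h⟩

theorem IsSupIdeal.closureC_subset {I : Set S} (hI : IsSupIdeal I) {U : Set S} (hU : U ⊆ I) :
    closureC U ⊆ I := by
  have key : ∀ n, preClosure^[n] U ⊆ I := by
    intro n
    induction n with
    | zero => exact hU
    | succ n ih =>
      rw [Function.iterate_succ_apply']
      rintro σ ⟨⟨V, hV, h⟩, -⟩
      exact hI.mem_of_setLe ih hV h
  rintro σ ⟨⟨n, hn⟩, -⟩
  exact key _ hn

theorem IsSupIdeal.closureC_maximal [WellFoundedGT S] {I : Set S} (hI : IsSupIdeal I) :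
    closureC {σ | Maximal (· ∈ I) σ} = {σ | Maximal (· ∈ I) σ} := by
  -- The candidates of the pre-closure are exactly the elements of `I`, so the set of maximal
  -- elements is a fixed point.
  have h1 : ∀ τ, (∃ V, SetLe V {σ | Maximal (· ∈ I) σ} ∧ IsLUB V τ) ↔ τ ∈ I := by
    intro τ
    constructor
    · rintro ⟨V, hV, h⟩
      exact hI.mem_of_setLe (fun σ hσ => hσ.1) hV h
    · intro h
      rw [← hI.lowerClosure_maximal] at h
      exact ⟨{τ}, by rintro _ rfl; exact h, isLUB_singleton⟩
  have h2 : preClosure {σ | Maximal (· ∈ I) σ} = {σ | Maximal (· ∈ I) σ} := by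
    unfold preClosure
    simp only [h1]
  have h3 : ∀ n, preClosure^[n] {σ | Maximal (· ∈ I) σ} = {σ | Maximal (· ∈ I) σ} :=
    fun n => Function.iterate_fixed h2 n
  unfold closureC
  simp only [h3]
  ext σ
  constructor
  · rintro ⟨⟨_, h⟩, -⟩
    exact h
  · intro h
    exact ⟨⟨0, h⟩, fun τ ⟨_, hτ⟩ hστ => h.2 hτ.1 hστ⟩

/-- A bounded `V` may be replaced by a finite `V₀` with the same supremum. The iterates of the
pre-closure increase, so `V₀` lies under a single one of them, and the next iterate dominates its
supremum. -/
theorem isSupIdeal_lowerClosure_closureC [WellFoundedGT S] (hrank : FiniteRank S) (U : Set S) :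
    IsSupIdeal (lowerClosure (closureC U) : Set S) := by
  refine ⟨(lowerClosure _).lower, fun V hV σ hσ => ?_⟩
  have hmono : Monotone fun n => lowerClosure (preClosure^[n + 1] U) :=
    monotone_nat_of_le_succ fun n => by
      rw [Function.iterate_succ_apply' _ (n + 1)]
      exact lowerClosure_le_preClosure _
  obtain ⟨V₀, hfin, hV₀, ρ, h1, h2⟩ := hrank V ⟨σ, hσ.1⟩
  obtain rfl := h1.unique hσ
  have : ∀ v ∈ V₀, ∃ n, v ∈ lowerClosure (preClosure^[n + 1] U) := by
    intro v hv
    obtain ⟨u, hu, hvu⟩ := hV₀ v hv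
    obtain ⟨τ, ⟨⟨n, hn⟩, -⟩, huτ⟩ := hV hu
    exact ⟨n, τ, hn, hvu.trans huτ⟩
  choose! n hn using this
  obtain ⟨N, hN⟩ := (hfin.image n).bddAbove
  have hle : SetLe V₀ (preClosure^[N + 1] U) := fun v hv => hmono (hN ⟨v, hv, rfl⟩) (hn v hv)
  obtain ⟨τ, hτ, h⟩ := exists_maximal_ge_of_wellFoundedGT
    (fun τ => ∃ V, SetLe V (preClosure^[N + 1] U) ∧ IsLUB V τ) _ ⟨V₀, hle, h2⟩
  have hmem : ∃ n : ℕ, τ ∈ preClosure^[n + 1] U :=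
    ⟨N + 1, by rw [Function.iterate_succ_apply']; exact h⟩
  obtain ⟨μ, hμ, h'⟩ := exists_maximal_ge_of_wellFoundedGT
    (fun τ => ∃ n : ℕ, τ ∈ preClosure^[n + 1] U) _ hmem
  exact ⟨μ, h', hτ.trans hμ⟩

end Ideals

/-! ### The states of the ontic completion -/

namespace OnticCompletion

variable {S : Type*} [PartialOrder S] [OrderBot S] {star : S → S}

/-- The lower set of the states of `S` which are below some element of `J`. -/
def ideal (J : OnticCompletion star) : Set S := lowerClosure J.1

theorem le_iff {J K : OnticCompletion star} : J ≤ K ↔ J.ideal ⊆ K.ideal := by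
  constructor
  · rintro h σ ⟨τ, hτ, hστ⟩
    obtain ⟨ρ, hρ, hτρ⟩ := h τ hτ
    exact ⟨ρ, hρ, hστ.trans hτρ⟩
  · intro h σ hσ
    exact h ⟨σ, hσ, le_rfl⟩

theorem ideal_injective {J K : OnticCompletion star} (h : J.ideal = K.ideal) : J = K :=
  le_antisymm (le_iff.2 h.subset) (le_iff.2 h.superset)

theorem isSupIdeal [WellFoundedGT S] (hrank : FiniteRank S) (J : OnticCompletion star) : IsSupIdeal J.ideal := by
  obtain ⟨_, U, _, rfl⟩ := J
  exact isSupIdeal_lowerClosure_closureC hrank U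

/-- Since `⋆` reverses the order, a conflict between elements of the ideal propagates up to elements
of the closure above them. -/
theorem not_star_le (hstar : IsStarSpace star) (J : OnticCompletion star) {σ τ : S}
    (hσ : σ ∈ J.ideal) (hτ : τ ∈ J.ideal) (hσ0 : σ ≠ ⊥) : ¬ star σ ≤ τ := by
  obtain ⟨_, U, hU, rfl⟩ := J
  obtain ⟨σ', hσ', hσσ'⟩ := hσ
  obtain ⟨τ', hτ', hττ'⟩ := hτ
  intro h
  rcases hU with ⟨_, _, hU⟩ | rfl
  · exact hU σ' hσ' τ' hτ' (((hstar.star_anti σ σ' hσ0 (ne_bot_of_le_ne_bot hσ0 hσσ') hσσ').trans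
      h).trans hττ')
  · have := (isSupIdeal_Iic (⊥ : S)).closureC_subset (U := {⊥}) (by simp) hσ'
    exact hσ0 (le_bot_iff.1 (hσσ'.trans this))

variable [WellFoundedGT S]

/-- The state whose elements are the maximal elements of a given ideal. -/
def ofIdeal (I : Set S) (hI : IsSupIdeal I)
    (h : ∀ σ ∈ I, ∀ τ ∈ I, σ ≠ ⊥ → τ ≠ ⊥ → ¬ star σ ≤ τ) : OnticCompletion star :=
  ⟨{σ | Maximal (· ∈ I) σ}, {σ | Maximal (· ∈ I) σ}, by
    rw [admissibleSets, Set.mem_union, Set.mem_ofPred_eq, hI.closureC_maximal]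
    -- If `⊥` is maximal in `I`, then `I = {⊥}`, the exceptional admissible set.
    by_cases hb : ⊥ ∈ {σ | Maximal (· ∈ I) σ}
    · right
      have h0 : ∀ σ ∈ I, σ = ⊥ := fun σ hσ => le_bot_iff.1 (hb.2 hσ bot_le)
      ext σ
      constructor
      · exact fun hσ => h0 σ hσ.1
      · rintro rfl
        exact hb
    · refine Or.inl ⟨hb, hb, fun σ hσ τ hτ => h σ hσ.1 τ hτ.1 ?_ ?_⟩
      · rintro rfl
        exact hb hσ
      · rintro rfl
        exact hb hτ, hI.closureC_maximal⟩

theorem ideal_ofIdeal (I : Set S) (hI : IsSupIdeal I)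
    (h : ∀ σ ∈ I, ∀ τ ∈ I, σ ≠ ⊥ → τ ≠ ⊥ → ¬ star σ ≤ τ) : (ofIdeal I hI h).ideal = I :=
  hI.lowerClosure_maximal

/-- The real state `{σ}`. -/
def principal (hstar : IsStarSpace star) (σ : S) : OnticCompletion star :=
  ofIdeal (Set.Iic σ) (isSupIdeal_Iic σ) fun a ha b hb ha0 _ h =>
    hstar.star_unbounded a ha0 ⟨σ, by
      rintro _ (rfl | rfl)
      · exact ha
      · exact h.trans hb⟩

variable (hstar : IsStarSpace star)

theorem ideal_principal (σ : S) : (principal hstar σ).ideal = Set.Iic σ := ideal_ofIdeal _ _ _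

theorem principal_val (σ : S) : (principal hstar σ).1 = {σ} := by
  ext τ
  constructor
  · intro h
    exact le_antisymm h.1 (h.2 (Set.mem_Iic.2 le_rfl) h.1)
  · rintro rfl
    exact ⟨le_rfl, fun ρ hρ _ => hρ⟩

theorem eq_principal {J : OnticCompletion star} {σ : S} (h : J.1 = {σ}) :
    J = principal hstar σ :=
  Subtype.ext (h.trans (principal_val hstar σ).symm)

theorem mem_carrier_iff {J : OnticCompletion star} :
    J ∈ (onticReal star).carrier ↔ ∃ σ, J = principal hstar σ := by
  constructor
  · rintro ⟨σ, h⟩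
    exact ⟨σ, eq_principal hstar h⟩
  · rintro ⟨σ, rfl⟩
    exact ⟨σ, principal_val hstar σ⟩

theorem principal_mem (σ : S) : principal hstar σ ∈ (onticReal star).carrier :=
  ⟨σ, principal_val hstar σ⟩

theorem star_iff {J K : OnticCompletion star} :
    (onticReal star).star J K ↔ ∃ σ, σ ≠ ⊥ ∧ J = principal hstar σ ∧ K = principal hstar (star σ) := by
  constructor
  · rintro ⟨σ, h0, h1, h2⟩
    exact ⟨σ, h0, eq_principal hstar h1, eq_principal hstar h2⟩
  · rintro ⟨σ, h0, rfl, rfl⟩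
    exact ⟨σ, h0, principal_val hstar _, principal_val hstar _⟩

theorem principal_le_iff (hrank : FiniteRank S) {σ : S} {J : OnticCompletion star} :
    principal hstar σ ≤ J ↔ σ ∈ J.ideal := by
  rw [le_iff, ideal_principal]
  exact ⟨fun h => h le_rfl, fun h τ hτ => (isSupIdeal hrank J).isLowerSet hτ h⟩

theorem principal_le_principal_iff {σ τ : S} :
    principal hstar σ ≤ principal hstar τ ↔ σ ≤ τ := by
  rw [le_iff, ideal_principal, ideal_principal, Set.Iic_subset_Iic]

end OnticCompletion

section Context

variable {P : Type*} [PartialOrder P] {R : RealData P}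

theorem isBot_coe {b : P} (hb : IsBot b) : IsBot (b : WithTop P)
  | ⊤ => le_top
  | (x : P) => WithTop.coe_le_coe.2 (hb x)

/-! ### Two kinds of contexts -/

/-- The effect `l_(a,·)`. -/
def Effect.test (a : WithTop P) : Effect P := ⟨a, ⊤, fun σ => by simp⟩

theorem RealData.IsRealEffect.pos_eq {l : Effect P} (hl : R.IsRealEffect l) :
    l.pos = ⊤ ∨ ∃ a ∈ R.carrier, l.pos = a := by
  rcases hl with ⟨a, ha, -, -, -, -, -, h, -⟩ | ⟨a, ha, h, -⟩ | ⟨_, -, h, -⟩ | ⟨h, -⟩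
  · exact Or.inr ⟨a, ha, h⟩
  · exact Or.inr ⟨a, ha, h⟩
  · exact Or.inl h
  · exact Or.inl h

theorem RealData.IsRealEffect.neg_eq {l : Effect P} (hl : R.IsRealEffect l) :
    l.neg = ⊤ ∨ ∃ a ∈ R.carrier, l.neg = a := by
  rcases hl with ⟨-, -, a, ha, -, -, -, -, h⟩ | ⟨-, -, -, h⟩ | ⟨a, ha, -, h⟩ | ⟨-, h⟩
  · exact Or.inr ⟨a, ha, h⟩
  · exact Or.inl h
  · exact Or.inr ⟨a, ha, h⟩
  · exact Or.inl h

theorem RealData.isRealEffect_test {a : WithTop P} (h : a = ⊤ ∨ ∃ b ∈ R.carrier, a = b) :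
    R.IsRealEffect (Effect.test a) := by
  rcases h with rfl | ⟨b, hb, rfl⟩
  · exact Or.inr (Or.inr (Or.inr ⟨rfl, rfl⟩))
  · exact Or.inr (Or.inl ⟨b, hb, rfl, rfl⟩)

theorem RealData.IsRealEffect.exists_star {l : Effect P} (hl : R.IsRealEffect l) {a a' : P}
    (h : l.pos = a) (h' : l.neg = a') : ∃ b, R.star a b ∧ b ≤ a' := by
  rcases hl with ⟨c, -, c', -, -, -, hb, e, e'⟩ | ⟨-, -, -, e⟩ | ⟨-, -, e, -⟩ | ⟨e, -⟩
  · rw [h, WithTop.coe_inj] at e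
    rw [h', WithTop.coe_inj] at e'
    rwa [e, e']
  · simp [h'] at e
  · simp [h] at e
  · simp [h] at e

/-- The real data contain a least element, and real effects are stable under conjugation. -/
structure RealData.IsRegular (R : RealData P) : Prop where
  exists_isBot : ∃ b ∈ R.carrier, IsBot b
  bar : ∀ l : Effect P, R.IsRealEffect l → R.IsRealEffect l.bar

/-- The family of indices attached to one effect. -/
def pairIndex (l : Effect P) (w : Bool × Bool) : WithTop P := if w.1 then l.pos else l.neg

theorem forall_pairIndex_le_iff (l : Effect P) (B : Set (Bool × Bool)) (σ : P) :
    (∀ w ∈ B, pairIndex l w ≤ σ) ↔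
      ((∃ i, (true, i) ∈ B) → l.pos ≤ σ) ∧ ((∃ i, (false, i) ∈ B) → l.neg ≤ σ) := by
  constructor
  · exact fun h => ⟨fun ⟨i, hi⟩ => h _ hi, fun ⟨i, hi⟩ => h _ hi⟩
  · rintro ⟨h1, h2⟩ ⟨_ | _, i⟩ hw
    · exact h2 ⟨i, hw⟩
    · exact h1 ⟨i, hw⟩

/-- A set of indices has supremum `·`, `l.pos`, `l.neg` or `⊥`. When two sets cover all indices and
both suprema are nonbottom states, one supremum is `l.pos` and the other `l.neg`; the star condition
is then that of `l` or of its conjugate. -/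
theorem isSeparating_pairIndex (hR : R.IsRegular) {l : Effect P} (hl : R.IsRealEffect l) :
    IsSeparating R (pairIndex l) := by
  refine ⟨fun σ => ?_, fun B => ?_, fun B B' hB a ha a' ha' h0 h0' h h' => ?_⟩
  · by_cases h : l.pos ≤ σ
    · exact ⟨(false, true), fun h' => l.no_common_bound σ ⟨h, h'⟩⟩
    · exact ⟨(true, true), h⟩
  · simp only [forall_pairIndex_le_iff]
    by_cases h1 : ∃ i, (true, i) ∈ B <;> by_cases h2 : ∃ i, (false, i) ∈ B
    · refine ⟨⊤, Or.inl rfl, fun σ => ?_⟩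
      simpa [h1, h2] using l.no_common_bound σ
    · exact ⟨l.pos, hl.pos_eq, fun σ => by simp [h1, h2]⟩
    · exact ⟨l.neg, hl.neg_eq, fun σ => by simp [h1, h2]⟩
    · obtain ⟨b, hb, hb'⟩ := hR.exists_isBot
      exact ⟨b, Or.inr ⟨b, hb, rfl⟩, fun σ => by simp [h1, h2, hb' σ]⟩
  · simp only [forall_pairIndex_le_iff] at h h'
    have hpos : (∃ i, (true, i) ∈ B) ∨ ∃ i, (true, i) ∈ B' :=
      (hB.symm.subset (Set.mem_univ (true, true))).imp (fun h => ⟨_, h⟩) fun h => ⟨_, h⟩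
    have hneg : (∃ i, (false, i) ∈ B) ∨ ∃ i, (false, i) ∈ B' :=
      (hB.symm.subset (Set.mem_univ (false, true))).imp (fun h => ⟨_, h⟩) fun h => ⟨_, h⟩
    have heq : ∀ (p : WithTop P) (c : P), (∀ σ : P, c ≤ σ ↔ p ≤ σ) → p = c := by
      intro p c hpc
      refine le_antisymm ((hpc c).1 le_rfl) ?_
      induction p using WithTop.recTopCoe with
      | top => exact le_top
      | coe p => exact WithTop.coe_le_coe.2 ((hpc p).2 le_rfl)
    have hcontra : ∀ c : P, (∀ σ : P, c ≤ σ ↔ l.pos ≤ σ ∧ l.neg ≤ σ) → False :=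
      fun c hc => l.no_common_bound c ((hc c).1 le_rfl)
    by_cases h1 : ∃ i, (true, i) ∈ B <;> by_cases h2 : ∃ i, (false, i) ∈ B
    · exact (hcontra a fun σ => by simpa [h1, h2] using h σ).elim
    · have h2' := hneg.resolve_left h2
      by_cases h1' : ∃ i, (true, i) ∈ B'
      · exact (hcontra a' fun σ => by simpa [h1', h2'] using h' σ).elim
      · exact hl.exists_star (heq _ _ fun σ => by simpa [h1, h2] using h σ)
          (heq _ _ fun σ => by simpa [h1', h2'] using h' σ)
    · have h1' := hpos.resolve_left h1
      by_cases h2' : ∃ i, (false, i) ∈ B'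
      · exact (hcontra a' fun σ => by simpa [h1', h2'] using h' σ).elim
      · exact (hR.bar l hl).exists_star (heq l.neg _ fun σ => by simpa [h1, h2] using h σ)
          (heq l.pos _ fun σ => by simpa [h1', h2'] using h' σ)
    · exact (h0 fun σ => by simp [h, h1, h2]).elim

/-- This context holds together all the effects needed to compare the outcome of `l` with those of
its conjugate and of `l_(l.pos,·)`. -/
theorem exists_cover_of_isRealEffect (hR : R.IsRegular) {l : Effect P} (hl : R.IsRealEffect l) :
    ∃ C ∈ cover R, l ∈ C ∧ l.bar ∈ C ∧ Effect.test l.pos ∈ C ∧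
      ∀ b ∈ R.carrier, IsBot b → Effect.test (b : WithTop P) ∈ C := by
  have hs := isSeparating_pairIndex hR hl
  obtain ⟨C, hC, hsub⟩ := hs.isContext.exists_mem_cover
  have htop : ∀ σ : P, ¬ (l.pos ≤ σ ∧ l.neg ≤ σ) := l.no_common_bound
  refine ⟨C, hC, hsub ⟨hl, fun w => if w.1 then .no else .yes, fun σ => ?_, fun σ => ?_⟩,
    hsub ⟨hR.bar l hl, fun w => if w.1 then .yes else .no, fun σ => ?_, fun σ => ?_⟩,
    -- Of the two copies of `l.pos` only one carries "no". The other carries "yes", so the negative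
    -- index must dominate both `l.pos` and `l.neg`, which forces `·`.
    hsub ⟨R.isRealEffect_test hl.pos_eq, fun w => if w.1 ∧ w.2 then .no else .yes,
      fun σ => ?_, fun σ => ?_⟩, fun b hb hb' =>
    hsub ⟨R.isRealEffect_test (Or.inr ⟨b, hb, rfl⟩), fun _ => .yes, fun σ => ?_, fun σ => ?_⟩⟩
  · simp [pairIndex]
  · simp [pairIndex]
  · simp [pairIndex, Effect.bar]
  · simp [pairIndex, Effect.bar]
  · simp [pairIndex, Effect.test]
  · have := htop σ
    simp [pairIndex, Effect.test]
    tauto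
  · simp [Effect.test, hb' σ]
  · have := htop σ
    simp [pairIndex, Effect.test]
    tauto

/-- The family of indices attached to the real states under `ω`. -/
def downIndex (R : RealData P) (ω : P) : {σ : P // σ ∈ R.carrier ∧ σ ≤ ω} ⊕ Bool → WithTop P :=
  Sum.elim (fun σ => (σ.1 : WithTop P)) fun _ => ⊤

theorem isSeparating_downIndex {ω : P}
    (hω : ∀ B : Set P, B ⊆ R.carrier → (∀ σ ∈ B, σ ≤ ω) → ∃ a ∈ R.carrier, IsLUB B a) :
    IsSeparating R (downIndex R ω) := by
  refine ⟨fun σ => ⟨Sum.inr true, by simp [downIndex]⟩, fun B => ?_,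
    fun B B' hB a ha a' ha' _ _ h h' => ?_⟩
  · by_cases hB : ∃ i, Sum.inr i ∈ B
    · obtain ⟨i, hi⟩ := hB
      refine ⟨⊤, Or.inl rfl, fun σ => ?_⟩
      simp only [top_le_iff, WithTop.coe_ne_top, false_iff]
      intro h
      simpa [downIndex] using h _ hi
    · obtain ⟨a, ha, hlub⟩ := hω {σ | ∃ h, Sum.inl ⟨σ, h⟩ ∈ B} (fun σ ⟨h, _⟩ => h.1) fun σ ⟨h, _⟩ => h.2
      refine ⟨a, Or.inr ⟨a, ha, rfl⟩, fun σ => ?_⟩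
      rw [WithTop.coe_le_coe, isLUB_le_iff hlub]
      constructor
      · rintro h (⟨τ, hτ⟩ | i) hw
        · exact WithTop.coe_le_coe.2 (h ⟨hτ, hw⟩)
        · exact (hB ⟨i, hw⟩).elim
      · rintro h τ ⟨hτ, hw⟩
        exact WithTop.coe_le_coe.1 (h _ hw)
  -- An index `·` falls in `B` or `B'`, so the two suprema cannot both be states and the star
  -- condition is vacuous.
  · rcases hB.symm.subset (Set.mem_univ (Sum.inr true)) with hw | hw
    · simpa [downIndex] using (h a).1 le_rfl _ hw
    · simpa [downIndex] using (h' a').1 le_rfl _ hw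

open Classical in
theorem contextOne_subset_contextOf (R : RealData P) (ω : P) :
    contextOne R ω ⊆ contextOf R (downIndex R ω) := by
  rintro l (⟨σ, hσ, hσω, h1, h2⟩ | ⟨σ, hσ, hσω, h1, h2⟩ | ⟨h1, h2⟩)
  · refine ⟨Or.inr (Or.inl ⟨σ, hσ, h1, h2⟩),
      fun w => if w = Sum.inl ⟨σ, hσ, hσω⟩ then .no else .yes, fun τ => ?_, fun τ => ?_⟩
    · simp [h1, downIndex]
    · simp only [h2, top_le_iff, WithTop.coe_ne_top, false_iff]
      intro h
      simpa [downIndex] using h (Sum.inr true)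
  · refine ⟨Or.inr (Or.inr (Or.inl ⟨σ, hσ, h1, h2⟩)),
      fun w => if w = Sum.inl ⟨σ, hσ, hσω⟩ then .yes else .no, fun τ => ?_, fun τ => ?_⟩
    · simp only [h1, top_le_iff, WithTop.coe_ne_top, false_iff]
      intro h
      simpa [downIndex] using h (Sum.inr true)
    · simp [h2, downIndex]
  -- The two copies of `·` receive different outcomes, so both indices of the effect are `·`.
  · refine ⟨Or.inr (Or.inr (Or.inr ⟨h1, h2⟩)),
      fun w => if w = Sum.inr true then .yes else .no, fun τ => ?_, fun τ => ?_⟩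
    · simp only [h1, top_le_iff, WithTop.coe_ne_top, false_iff]
      intro h
      simpa [downIndex] using h (Sum.inr false)
    · simp only [h2, top_le_iff, WithTop.coe_ne_top, false_iff]
      intro h
      simpa [downIndex] using h (Sum.inr true)

theorem exists_cover_contextOne_subset {ω : P}
    (hω : ∀ B : Set P, B ⊆ R.carrier → (∀ σ ∈ B, σ ≤ ω) → ∃ a ∈ R.carrier, IsLUB B a) :
    ∃ C ∈ cover R, contextOne R ω ⊆ C := by
  obtain ⟨C, hC, h⟩ := (isSeparating_downIndex hω).isContext.exists_mem_cover
  exact ⟨C, hC, (contextOne_subset_contextOf R ω).trans h⟩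

theorem sUnion_cover (hR : R.IsRegular) : ⋃₀ cover R = {l | R.IsRealEffect l} := by
  ext l
  constructor
  · rintro ⟨C, hC, hl⟩
    exact hC.1.1 l hl
  · intro hl
    obtain ⟨C, hC, h, -⟩ := exists_cover_of_isRealEffect hR hl
    exact ⟨C, hC, h⟩

/-! ### The outcomes of a coherent description -/

namespace EmpiricalModel

open Classical in
/-- The outcome attributed to an effect in all the maximal contexts to which it belongs. -/
noncomputable def outcome (D : EmpiricalModel R) (l : Effect P) : Outcome :=
  if h : ∃ C : cover R, l ∈ C.1 then D.d h.choose ⟨l, h.choose_spec⟩ else .bot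

variable (D : EmpiricalModel R)

theorem d_eq_outcome (C : cover R) (l : ↥C.1) : D.d C l = D.outcome l.1 := by
  have h : ∃ C : cover R, l.1 ∈ C.1 := ⟨C, l.2⟩
  rw [outcome, dif_pos h]
  exact D.coherent _ _ _ _ _

theorem outcome_of_isYes {C : Set (Effect P)} (hC : C ∈ cover R) {l : Effect P} (hl : l ∈ C)
    (h : l.IsYes) : D.outcome l = .yes := by
  rw [← D.d_eq_outcome ⟨C, hC⟩ ⟨l, hl⟩]
  exact D.d_yes _ _ h

theorem outcome_bar_of_mem {C : Set (Effect P)} (hC : C ∈ cover R) {l : Effect P} (hl : l ∈ C)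
    (hl' : l.bar ∈ C) : D.outcome l.bar = (D.outcome l).bar := by
  rw [← D.d_eq_outcome ⟨C, hC⟩ ⟨l, hl⟩, ← D.d_eq_outcome ⟨C, hC⟩ ⟨l.bar, hl'⟩]
  exact D.d_bar _ _ _ rfl

theorem outcome_isGLB {C : Set (Effect P)} (hC : C ∈ cover R) {L : Set (Effect P)} (hL : L ⊆ C)
    (hne : L.Nonempty) {l : Effect P} (hl : l ∈ C) (h : IsGLB L l) :
    IsGLB (D.outcome '' L) (D.outcome l) := by
  have e : (Subtype.val '' (Subtype.val ⁻¹' L : Set ↥C)) = L := by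
    rw [Subtype.image_preimage_coe, Set.inter_eq_right]
    exact hL
  have := D.d_inf ⟨C, hC⟩ (Subtype.val ⁻¹' L) ⟨l, hl⟩ (by
    obtain ⟨k, hk⟩ := hne
    exact ⟨⟨k, hL hk⟩, hk⟩) (by rwa [e])
  rw [D.d_eq_outcome] at this
  have e' : D.d ⟨C, hC⟩ = D.outcome ∘ Subtype.val := funext fun l => D.d_eq_outcome _ _
  rw [e', Set.image_comp, e] at this
  exact this

variable (hR : R.IsRegular)
include hR

theorem outcome_bar {l : Effect P} (hl : R.IsRealEffect l) :
    D.outcome l.bar = (D.outcome l).bar := by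
  obtain ⟨C, hC, h1, h2, -⟩ := exists_cover_of_isRealEffect hR hl
  exact D.outcome_bar_of_mem hC h1 h2

/-- In the space of effects `l_(σ,·)` is the infimum of `l_(σ,σ')` and the unit effect, and all
three lie in one maximal context. -/
theorem outcome_test_pos {l : Effect P} (hl : R.IsRealEffect l) :
    D.outcome (Effect.test l.pos) = D.outcome l ⊓ .yes := by
  obtain ⟨b, hb, hbot⟩ := hR.exists_isBot
  obtain ⟨C, hC, h1, -, h2, h3⟩ := exists_cover_of_isRealEffect hR hl
  have hbot' := isBot_coe hbot
  have hglb : IsGLB {l, Effect.test (b : WithTop P)} (Effect.test l.pos) := by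
    refine ⟨?_, fun m hm => ⟨(hm (by simp : l ∈ _)).1, ?_⟩⟩
    · rintro _ (rfl | rfl)
      · exact ⟨le_rfl, le_top⟩
      · exact ⟨hbot' _, le_rfl⟩
    · exact (hm (Set.mem_insert_of_mem _ rfl)).2
  have := D.outcome_isGLB hC (by
    rintro _ (rfl | rfl)
    · exact h1
    · exact h3 b hb hbot) ⟨l, by simp⟩ h2 hglb
  rw [Set.image_pair, D.outcome_of_isYes hC (h3 b hb hbot) ⟨hbot', rfl⟩] at this
  exact this.unique isGLB_pair

theorem outcome_eq_yes_iff {l : Effect P} (hl : R.IsRealEffect l) :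
    D.outcome l = .yes ↔ D.outcome (Effect.test l.pos) = .yes := by
  rw [D.outcome_test_pos hR hl]
  exact ⟨fun h => by rw [h, inf_idem], fun h => Outcome.yes_le_iff.1 (h ▸ inf_le_left)⟩

theorem outcome_eq_no_iff {l : Effect P} (hl : R.IsRealEffect l) :
    D.outcome l = .no ↔ D.outcome (Effect.test l.neg) = .yes := by
  rw [show l.neg = l.bar.pos from rfl, ← D.outcome_eq_yes_iff hR (hR.bar l hl),
    D.outcome_bar hR hl]
  cases D.outcome l <;> simp [Outcome.bar]

/-- The effect `l_(·,·)` is its own conjugate, and `bot` is the only outcome fixed by the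
involution. -/
theorem outcome_test_top : D.outcome (Effect.test ⊤) = .bot := by
  have hl := R.isRealEffect_test (a := ⊤) (Or.inl rfl)
  have h := D.outcome_bar hR hl
  rw [show (Effect.test (⊤ : WithTop P)).bar = Effect.test ⊤ from rfl] at h
  cases e : D.outcome (Effect.test ⊤) <;> simp_all [Outcome.bar]

theorem outcome_eq_eval {σ : P}
    (h : ∀ a ∈ R.carrier, D.outcome (Effect.test (a : WithTop P)) = .yes ↔ a ≤ σ)
    {l : Effect P} (hl : R.IsRealEffect l) : D.outcome l = l.eval σ := by
  have key : ∀ p : WithTop P, (p = ⊤ ∨ ∃ a ∈ R.carrier, p = a) →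
      (D.outcome (Effect.test p) = .yes ↔ p ≤ σ) := by
    rintro _ (rfl | ⟨a, ha, rfl⟩)
    · simp [D.outcome_test_top hR]
    · rw [h a ha, WithTop.coe_le_coe]
  apply Outcome.ext_yes_no
  · rw [D.outcome_eq_yes_iff hR hl, key _ hl.pos_eq, Effect.eval_eq_yes_iff]
  · rw [D.outcome_eq_no_iff hR hl, key _ hl.neg_eq, Effect.eval_eq_no_iff]

end EmpiricalModel

/-- The outcomes given by the evaluations on a state. -/
noncomputable def evalModel (R : RealData P) (σ : P) : EmpiricalModel R where
  d C l := l.1.eval σ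
  d_yes C l h := by
    rw [Effect.eval_eq_yes_iff]
    exact h.1 _
  d_bar C l l' h := by rw [h, Effect.eval_bar]
  d_inf C L l hL h := by
    have := Effect.eval_isGLB (hL.image _) h σ
    rwa [Set.image_image] at this
  coherent C C' l h h' := rfl

end Context

/-! ### Suprema, real states and pure states of the completion -/

theorem IsStarSpace.exists_isLUB {S : Type*} [PartialOrder S] [OrderBot S] {star : S → S}
    (hstar : IsStarSpace star) {U : Set S} (hU : BddAbove U) : ∃ σ, IsLUB U σ := by
  obtain ⟨σ, hσ⟩ := hstar.exists_inf (upperBounds U) hU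
  exact ⟨σ, isGLB_upperBounds.1 hσ⟩

theorem exists_isMax_ge {S : Type*} [PartialOrder S] [WellFoundedGT S] (σ : S) :
    ∃ ω, IsMax ω ∧ σ ≤ ω := by
  obtain ⟨ω, h, hω⟩ := exists_maximal_ge_of_wellFoundedGT (fun _ : S => True) σ trivial
  exact ⟨ω, fun τ hτ => hω.2 trivial hτ, h⟩

namespace OnticCompletion

variable {S : Type*} [PartialOrder S] [OrderBot S] {star : S → S} [WellFoundedGT S]
  (hstar : IsStarSpace star)

theorem isBot_principal_iff {σ : S} (hrank : FiniteRank S) :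
    IsBot (principal hstar σ) ↔ σ = ⊥ := by
  constructor
  · intro h
    exact le_bot_iff.1 ((principal_le_principal_iff hstar).1 (h (principal hstar ⊥)))
  · rintro rfl J
    rw [principal_le_iff hstar hrank]
    exact (isSupIdeal hrank J).lub_mem ∅ (Set.empty_subset _) ⊥ isLUB_empty

theorem isRegular (hstar : IsStarSpace star) (hrank : FiniteRank S) :
    (onticReal star).IsRegular := by
  refine ⟨⟨_, principal_mem hstar ⊥, (isBot_principal_iff hstar hrank).2 rfl⟩, fun l hl => ?_⟩
  rcases hl with ⟨a, ha, a', ha', h0, h0', ⟨b, hab, hb⟩, h, h'⟩ | h | h | h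
  · obtain ⟨σ, hσ, rfl, rfl⟩ := (star_iff hstar).1 hab
    obtain ⟨τ, rfl⟩ := (mem_carrier_iff hstar).1 ha'
    have hτ : τ ≠ ⊥ := fun e => h0' ((isBot_principal_iff hstar hrank).2 e)
    refine Or.inl ⟨_, ha', _, ha, h0', h0, ⟨_, (star_iff hstar).2 ⟨τ, hτ, rfl, rfl⟩, ?_⟩, h', h⟩
    rw [principal_le_principal_iff] at hb ⊢
    -- From `σ⋆ ≤ τ` follows `τ⋆ ≤ σ⋆⋆ = σ`.
    have := hstar.star_anti _ _ (hstar.star_ne_bot σ hσ) hτ hb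
    rwa [hstar.star_star σ hσ] at this
  · obtain ⟨a, ha, h1, h2⟩ := h
    exact Or.inr (Or.inr (Or.inl ⟨a, ha, h2, h1⟩))
  · obtain ⟨a, ha, h1, h2⟩ := h
    exact Or.inr (Or.inl ⟨a, ha, h2, h1⟩)
  · exact Or.inr (Or.inr (Or.inr h.symm))

/-- The supremum formed in `S'` remains a supremum in the completion, because the ideals of its
states are closed under suprema. -/
theorem exists_isLUB_of_le (hrank : FiniteRank S) (σ : S) (B : Set (OnticCompletion star))
    (hB : B ⊆ (onticReal star).carrier) (hle : ∀ J ∈ B, J ≤ principal hstar σ) :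
    ∃ J ∈ (onticReal star).carrier, IsLUB B J := by
  have hV : principal hstar '' (principal hstar ⁻¹' B) = B := by
    rw [Set.image_preimage_eq_iff]
    intro J hJ
    obtain ⟨τ, rfl⟩ := (mem_carrier_iff hstar).1 (hB hJ)
    exact ⟨τ, rfl⟩
  obtain ⟨τ, hτ⟩ := hstar.exists_isLUB (U := principal hstar ⁻¹' B)
    ⟨σ, fun τ hτ => (principal_le_principal_iff hstar).1 (hle _ hτ)⟩
  refine ⟨_, principal_mem hstar τ, ?_⟩
  rw [← hV]
  refine ⟨?_, fun K hK => ?_⟩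
  · rintro _ ⟨ρ, hρ, rfl⟩
    exact (principal_le_principal_iff hstar).2 (hτ.1 hρ)
  · rw [principal_le_iff hstar hrank]
    refine (isSupIdeal hrank K).lub_mem _ (fun ρ hρ => ?_) τ hτ
    exact (principal_le_iff hstar hrank).1 (hK ⟨ρ, hρ, rfl⟩)

theorem mem_pure_iff {J : OnticCompletion star} :
    J ∈ (onticReal star).pure ↔ ∃ ω, IsMax ω ∧ J = principal hstar ω := by
  constructor
  · rintro ⟨hJ, hmax⟩
    obtain ⟨ω, rfl⟩ := (mem_carrier_iff hstar).1 hJ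
    refine ⟨ω, fun τ hτ => ?_, rfl⟩
    exact (principal_le_principal_iff hstar).1
      (hmax (principal_mem hstar τ) ((principal_le_principal_iff hstar).2 hτ))
  · rintro ⟨ω, hω, rfl⟩
    refine ⟨principal_mem hstar ω, fun K hK h => ?_⟩
    obtain ⟨τ, rfl⟩ := (mem_carrier_iff hstar).1 hK
    rw [principal_le_principal_iff] at h ⊢
    exact hω h

theorem exists_cover_contextOne (hstar : IsStarSpace star) (hrank : FiniteRank S)
    {ω : OnticCompletion star} (hω : ω ∈ (onticReal star).carrier) :
    ∃ C ∈ cover (onticReal star), contextOne (onticReal star) ω ⊆ C := by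
  obtain ⟨σ, rfl⟩ := (mem_carrier_iff hstar).1 hω
  exact exists_cover_contextOne_subset (exists_isLUB_of_le hstar hrank σ)

end OnticCompletion

/-! ### The state attached to a coherent description -/

namespace EmpiricalModel

open OnticCompletion

variable {S : Type*} [PartialOrder S] [OrderBot S] {star : S → S} [WellFoundedGT S]
  (hstar : IsStarSpace star) (hrank : FiniteRank S) (D : EmpiricalModel (onticReal star))

/-- The states `σ` to which `D` attributes the outcome "yes". -/
def yesIdeal : Set S :=
  {σ | D.outcome (Effect.test (principal hstar σ : OnticCompletion star)) = .yes}

/-- The effect `l_(σ,·)` is the infimum of the `l_(τ,·)`, `τ ∈ V`, even among effects with hidden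
indices, and the context of the states under `σ` contains them all. -/
theorem mem_yesIdeal_iff_of_isLUB (hrank : FiniteRank S) {V : Set S} (hne : V.Nonempty) {σ : S}
    (hσ : IsLUB V σ) : σ ∈ D.yesIdeal hstar ↔ V ⊆ D.yesIdeal hstar := by
  let f : S → Effect (OnticCompletion star) := fun τ => Effect.test (principal hstar τ)
  obtain ⟨C, hC, h⟩ := exists_cover_contextOne hstar hrank (principal_mem hstar σ)
  have hmem : ∀ τ ≤ σ, f τ ∈ C := fun τ hτ => h (Or.inl ⟨_, principal_mem hstar τ,
    (principal_le_principal_iff hstar).2 hτ, rfl, rfl⟩)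
  have hglb : IsGLB (f '' V) (f σ) := by
    refine ⟨?_, fun m hm => ⟨?_, ?_⟩⟩
    · rintro _ ⟨τ, hτ, rfl⟩
      exact ⟨WithTop.coe_le_coe.2 ((principal_le_principal_iff hstar).2 (hσ.1 hτ)), le_rfl⟩
    · have hm' : ∀ τ ∈ V, (principal hstar τ : WithTop (OnticCompletion star)) ≤ m.pos :=
        fun τ hτ => (hm ⟨τ, hτ, rfl⟩).1
      change (principal hstar σ : WithTop (OnticCompletion star)) ≤ m.pos
      cases e : m.pos using WithTop.recTopCoe with
      | top => exact le_top
      | coe J =>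
        rw [WithTop.coe_le_coe, principal_le_iff hstar hrank]
        refine (isSupIdeal hrank J).lub_mem V (fun τ hτ => ?_) σ hσ
        have := hm' τ hτ
        rwa [e, WithTop.coe_le_coe, principal_le_iff hstar hrank] at this
    · obtain ⟨τ, hτ⟩ := hne
      exact (hm ⟨τ, hτ, rfl⟩).2
  have := D.outcome_isGLB hC (by
    rintro _ ⟨τ, hτ, rfl⟩
    exact hmem τ (hσ.1 hτ)) (hne.image f) (hmem σ le_rfl) hglb
  rw [Outcome.isGLB_iff ((hne.image f).image _)] at this
  simp only [Set.forall_mem_image] at this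
  exact this.1

theorem isSupIdeal_yesIdeal (hrank : FiniteRank S) : IsSupIdeal (D.yesIdeal hstar) := by
  refine ⟨fun τ σ hστ hτ => ?_, fun V hV σ hσ => ?_⟩
  · have hlub : IsLUB {σ, τ} τ := 
      IsGreatest.isLUB ⟨by simp, by simp [upperBounds, hστ]⟩
    exact (D.mem_yesIdeal_iff_of_isLUB hstar hrank ⟨σ, by simp⟩ hlub).1 hτ (by simp)
  · rcases V.eq_empty_or_nonempty with rfl | hne
    · have hb : IsBot (principal hstar σ) :=
        (isBot_principal_iff hstar hrank).2 (hσ.unique isLUB_empty)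
      obtain ⟨C, hC, h⟩ := exists_cover_contextOne hstar hrank (principal_mem hstar σ)
      refine D.outcome_of_isYes hC (h (Or.inl ⟨_, principal_mem hstar σ, le_rfl, rfl, rfl⟩))
        ⟨isBot_coe hb, rfl⟩
    · exact (D.mem_yesIdeal_iff_of_isLUB hstar hrank hne hσ).2 hV

theorem not_star_le_of_mem_yesIdeal (hrank : FiniteRank S) {σ τ : S} (hσ : σ ∈ D.yesIdeal hstar)
    (hτ : τ ∈ D.yesIdeal hstar) (hσ0 : σ ≠ ⊥) (hτ0 : τ ≠ ⊥) : ¬ star σ ≤ τ := by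
  intro h
  let l : Effect (OnticCompletion star) := ⟨principal hstar σ, principal hstar τ, by
    rintro J ⟨h1, h2⟩
    rw [WithTop.coe_le_coe, principal_le_iff hstar hrank] at h1 h2
    exact J.not_star_le hstar h1 h2 hσ0 h⟩
  have hl : (onticReal star).IsRealEffect l := Or.inl ⟨_, principal_mem hstar σ, _,
    principal_mem hstar τ, fun h => hσ0 ((isBot_principal_iff hstar hrank).1 h),
    fun h => hτ0 ((isBot_principal_iff hstar hrank).1 h),
    ⟨_, (star_iff hstar).2 ⟨σ, hσ0, rfl, rfl⟩, (principal_le_principal_iff hstar).2 h⟩, rfl, rfl⟩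
  have hR := isRegular hstar hrank
  have h1 : D.outcome l = .yes := (D.outcome_eq_yes_iff hR hl).2 hσ
  have h2 : D.outcome l = .no := (D.outcome_eq_no_iff hR hl).2 hτ
  simp [h1] at h2

/-- The state of the completion attached to `D`. -/
def toState : OnticCompletion star :=
  ofIdeal (D.yesIdeal hstar) (D.isSupIdeal_yesIdeal hstar hrank)
    fun _ hσ _ hτ => D.not_star_le_of_mem_yesIdeal hstar hrank hσ hτ

theorem ideal_toState : (D.toState hstar hrank).ideal = D.yesIdeal hstar := ideal_ofIdeal _ _ _

theorem outcome_eq_eval_toState {l : Effect (OnticCompletion star)}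
    (hl : (onticReal star).IsRealEffect l) : D.outcome l = l.eval (D.toState hstar hrank) := by
  refine D.outcome_eq_eval (isRegular hstar hrank) (fun a ha => ?_) hl
  obtain ⟨σ, rfl⟩ := (mem_carrier_iff hstar).1 ha
  rw [principal_le_iff hstar hrank, ideal_toState]
  rfl

theorem d_eq_eval_toState (C : cover (onticReal star)) (l : ↥C.1) :
    D.d C l = l.1.eval (D.toState hstar hrank) := by
  rw [D.d_eq_outcome, D.outcome_eq_eval_toState hstar hrank (C.2.1.1 l.1 l.2)]

theorem toState_evalModel (J : OnticCompletion star) :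
    (evalModel (onticReal star) J).toState hstar hrank = J := by
  apply ideal_injective
  rw [ideal_toState]
  ext σ
  have hl := (onticReal star).isRealEffect_test (Or.inr ⟨_, principal_mem hstar σ, rfl⟩)
  obtain ⟨C, hC, h, -⟩ := exists_cover_of_isRealEffect (isRegular hstar hrank) hl
  have := (evalModel (onticReal star) J).d_eq_outcome ⟨C, hC⟩ ⟨_, h⟩
  rw [yesIdeal, Set.mem_ofPred_eq, ← this, ← principal_le_iff hstar hrank]
  change Effect.eval _ J = _ ↔ _
  rw [Effect.eval_eq_yes_iff]
  exact WithTop.coe_le_coe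

/-- Coherent descriptions correspond to the states of the completion. -/
noncomputable def stateIso : EmpiricalModel (onticReal star) ≃o OnticCompletion star where
  toFun D := D.toState hstar hrank
  invFun J := evalModel _ J
  left_inv D := EmpiricalModel.ext (funext fun C => funext fun l =>
    (D.d_eq_eval_toState hstar hrank C l).symm)
  right_inv J := toState_evalModel hstar hrank J
  map_rel_iff' {D D'} := by
    constructor
    · intro h C l
      rw [D.d_eq_eval_toState hstar hrank, D'.d_eq_eval_toState hstar hrank]
      exact l.1.eval_mono h
    · intro h
      change D.toState hstar hrank ≤ D'.toState hstar hrank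
      rw [le_iff, ideal_toState, ideal_toState]
      intro σ hσ
      have hl := (onticReal star).isRealEffect_test (Or.inr ⟨_, principal_mem hstar σ, rfl⟩)
      obtain ⟨C, hC, hmem, -⟩ := exists_cover_of_isRealEffect (isRegular hstar hrank) hl
      have := h ⟨C, hC⟩ ⟨_, hmem⟩
      rw [D.d_eq_outcome, D'.d_eq_outcome, show D.outcome _ = Outcome.yes from hσ,
        Outcome.yes_le_iff] at this
      exact this

theorem definedGlobally_iff :
    D.DefinedGlobally ↔ D.toState hstar hrank ∈ (onticReal star).carrier := by
  constructor
  · rintro ⟨J, hJ, h⟩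
    have : D = evalModel _ J := EmpiricalModel.ext (funext fun C => funext fun l => h C l)
    rwa [this, toState_evalModel]
  · exact fun h => ⟨_, h, D.d_eq_eval_toState hstar hrank⟩

/-- The greatest state under `σ` to which `D` attributes the outcome "yes". -/
theorem exists_isGreatest_yesIdeal (hrank : FiniteRank S) (σ : S) :
    ∃ τ, IsGreatest (D.yesIdeal hstar ∩ Set.Iic σ) τ := by
  obtain ⟨τ, hτ⟩ := hstar.exists_isLUB (U := D.yesIdeal hstar ∩ Set.Iic σ) ⟨σ, fun _ h => h.2⟩
  exact ⟨τ, ⟨(D.isSupIdeal_yesIdeal hstar hrank).lub_mem _ Set.inter_subset_left τ hτ,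
    hτ.2 fun _ h => h.2⟩, hτ.1⟩

/-- The effects of this context only test real states under `σ`, and such a state is below `τ`
exactly when it lies in the ideal of `D`. -/
theorem isOnticState_principal {σ τ : S} (h : IsGreatest (D.yesIdeal hstar ∩ Set.Iic σ) τ)
    (hrank : FiniteRank S) (C : cover (onticReal star))
    (hC : contextOne (onticReal star) (principal hstar σ) ⊆ C.1) :
    D.IsOnticState C _ hC (principal hstar τ) := by
  have hiff : ∀ a ∈ (onticReal star).carrier, a ≤ principal hstar σ →
      (a ≤ principal hstar τ ↔ a ≤ D.toState hstar hrank) := by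
    intro a ha haσ
    obtain ⟨ρ, rfl⟩ := (mem_carrier_iff hstar).1 ha
    rw [principal_le_principal_iff] at haσ ⊢
    rw [principal_le_iff hstar hrank, ideal_toState]
    exact ⟨fun hρ => (D.isSupIdeal_yesIdeal hstar hrank).isLowerSet hρ h.1.1,
      fun hρ => h.2 ⟨hρ, haσ⟩⟩
  have heval : ∀ (l : Effect (OnticCompletion star))
      (hl : l ∈ contextOne (onticReal star) (principal hstar σ)),
      l.eval (principal hstar τ) = D.d C ⟨l, hC hl⟩ := by
    intro l hl
    rw [D.d_eq_eval_toState hstar hrank]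
    apply Outcome.ext_yes_no
    · rw [Effect.eval_eq_yes_iff, Effect.eval_eq_yes_iff]
      rcases hl with ⟨a, ha, ha', h1, -⟩ | ⟨-, -, -, h1, -⟩ | ⟨h1, -⟩ <;> rw [h1]
      · simpa only [WithTop.coe_le_coe] using hiff a ha ha'
      · simp
      · simp
    · rw [Effect.eval_eq_no_iff, Effect.eval_eq_no_iff]
      rcases hl with ⟨-, -, -, -, h1⟩ | ⟨a, ha, ha', -, h1⟩ | ⟨-, h1⟩ <;> rw [h1]
      · simp
      · simpa only [WithTop.coe_le_coe] using hiff a ha ha'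
      · simp
  refine ⟨principal_mem hstar τ, heval, IsLeast.isGLB ⟨⟨principal_mem hstar τ,
    fun l hl => (heval l hl).ge⟩, fun J hJ => ?_⟩⟩
  -- The effect `l_(τ,·)` belongs to the context and has outcome "yes", so any competing real state
  -- is above `τ`; the infimum is in fact a minimum.
  have hl : Effect.test (principal hstar τ : WithTop (OnticCompletion star)) ∈
      contextOne (onticReal star) (principal hstar σ) :=
    Or.inl ⟨_, principal_mem hstar τ, (principal_le_principal_iff hstar).2 h.1.2, rfl, rfl⟩
  have := hJ.2 _ hl
  rw [← heval _ hl, (Effect.eval_eq_yes_iff _ _).2 le_rfl, Outcome.yes_le_iff,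
    Effect.eval_eq_yes_iff] at this
  exact WithTop.coe_le_coe.1 this

end EmpiricalModel

end Ontic

/-! ### The main theorem -/

open Ontic OnticCompletion EmpiricalModel in
theorem mainTheorem7 {S' : Type*} [PartialOrder S'] [OrderBot S'] (star : S' → S')
    (hstar : Ontic.IsStarSpace star) (hrank : Ontic.FiniteRank S')
    (hchain : ∀ c : Set S', IsChain (· ≤ ·) c → BddAbove c) :
    (∀ σ : S', ∃ J : Ontic.OnticCompletion star, J.1 = {σ}) ∧
    (⋃₀ Ontic.cover (Ontic.onticReal star) = {l | (Ontic.onticReal star).IsRealEffect l}) ∧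
    (∀ ω ∈ (Ontic.onticReal star).pure, ∃ C ∈ Ontic.cover (Ontic.onticReal star),
      Ontic.contextOne (Ontic.onticReal star) ω ⊆ C) ∧
    ∃ (onticState : Ontic.EmpiricalModel (Ontic.onticReal star) →
          (Ontic.onticReal star).pure → Ontic.OnticCompletion star)
      (e : Ontic.EmpiricalModel (Ontic.onticReal star) ≃o Ontic.OnticCompletion star),
      (∀ (D : Ontic.EmpiricalModel (Ontic.onticReal star)) (ω : (Ontic.onticReal star).pure)
          (C : Ontic.cover (Ontic.onticReal star))
          (h : Ontic.contextOne (Ontic.onticReal star) ω.1 ⊆ C.1),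
        D.IsOnticState C (Ontic.contextOne (Ontic.onticReal star) ω.1) h (onticState D ω)) ∧
      (∀ D, IsLUB (Set.range (onticState D)) (e D)) ∧
      (∀ D₁ D₂, IsGLB {e D₁, e D₂} (e (D₁ ⊓ D₂))) ∧
      (∀ (D : Ontic.EmpiricalModel (Ontic.onticReal star)) (C : Ontic.cover (Ontic.onticReal star))
          (l : ↥C.1),
        D.d C l = l.1.eval (e D)) ∧
      (∀ D, e D ∈ Ontic.hiddenStates star ↔ ¬ D.DefinedGlobally) ∧
      (¬ Ontic.NonContextual (Ontic.onticReal star) ↔ (Ontic.hiddenStates star).Nonempty) := by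
  have := hrank.wellFoundedGT hchain
  have hhidden : ∀ D : EmpiricalModel (onticReal star),
      stateIso hstar hrank D ∈ hiddenStates star ↔ ¬ D.DefinedGlobally :=
    fun D => not_congr (D.definedGlobally_iff hstar hrank).symm
  refine ⟨fun σ => ⟨_, principal_val hstar σ⟩, sUnion_cover (isRegular hstar hrank),
    fun ω hω => exists_cover_contextOne hstar hrank hω.1, ?_⟩
  choose s hs hω using fun ω : (onticReal star).pure => (mem_pure_iff hstar).1 ω.2
  choose t ht using fun (D : EmpiricalModel (onticReal star)) (ω : (onticReal star).pure) =>
    D.exists_isGreatest_yesIdeal hstar hrank (s ω)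
  refine ⟨fun D ω => principal hstar (t D ω), stateIso hstar hrank, ?_, fun D => ⟨?_, ?_⟩, ?_,
    fun D => D.d_eq_eval_toState hstar hrank, hhidden, ?_⟩
  · rintro D ω C h
    have key := D.isOnticState_principal hstar (ht D ω) hrank C
    rw [← hω ω] at key
    exact key h
  · rintro _ ⟨ω, rfl⟩
    rw [principal_le_iff hstar hrank]
    exact (D.ideal_toState hstar hrank).symm ▸ (ht D ω).1.1
  · intro K hK
    change D.toState hstar hrank ≤ K
    rw [le_iff, ideal_toState]
    intro σ hσ
    -- An element of the ideal of `D` lies under some maximal `ω`, hence under the greatest element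
    -- of the ideal below `ω`, which any upper bound `K` contains.
    obtain ⟨ω, hmax, hle⟩ := exists_isMax_ge σ
    let Ω : (onticReal star).pure := ⟨_, (mem_pure_iff hstar).2 ⟨ω, hmax, rfl⟩⟩
    have hΩ : ω ≤ s Ω := (principal_le_principal_iff hstar).1 (hω Ω).le
    have h := (principal_le_iff hstar hrank).1 (hK ⟨Ω, rfl⟩)
    exact (isSupIdeal hrank K).isLowerSet ((ht D Ω).2 ⟨hσ, hle.trans hΩ⟩) h
  · intro D₁ D₂
    have h := (stateIso hstar hrank).isGLB_image'.2 (isGLB_pair (a := D₁) (b := D₂))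
    rwa [Set.image_pair] at h
  · rw [NonContextual, not_forall]
    constructor
    · rintro ⟨D, hD⟩
      exact ⟨_, (hhidden D).2 hD⟩
    · rintro ⟨J, hJ⟩
      refine ⟨(stateIso hstar hrank).symm J, (hhidden _).1 ?_⟩
      rwa [OrderIso.apply_symm_apply]
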